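/- Let $\Lambda=K[p_1,p_2,\dots]$ be the ring of symmetric functions over a commutative ring $K$ containing $\mathbb{Q}$, let $s_\lambda$ denote the Schur functions, $\lambda'$ the conjugate of a partition $\lambda$, and $f[g]$ the plethysm: $p_r[g]$ is obtained from $g$ (which has rational coefficients) by replacing every $p_i$ by $p_{ri}$, and $f[g]$ is obtained from $f$ by replacing every $p_r$ by $p_r[g]$. Let $c^\mu_{\nu\gamma}=\langle s_\mu,s_\nu s_\gamma\rangle$ be the Littlewood–Richardson coefficients, where $\langle\cdot,\cdot\rangle$ is the Hall inner product. A partition is called even if all columns of its Young diagram have even length; $b_\mu$ denotes the number of corners of $\mu$, that is, of cells $(r,c)$ of $\mu$ such that neither $(r+1,c)$ nor $(r,c+1)$ is a cell of $\mu$. Let $\mathcal{P}_{2h}$ be the set of partitions of $2h$ all of whose columns have even length except for two columns, which have distinct odd lengths. Then for every integer $h\ge 3$, $$s_{(h-2,1,1)}[s_{(1,1)}]=\sum_{\mu\vdash 2h}a_\mu s_\mu,\qquad s_{(h-2,1,1)}[s_{(2)}]=\sum_{\mu\vdash 2h}a_\mu s_{\mu'},$$ where $$a_\mu=\begin{cases}\binom{b_\mu-1}{2}&\text{if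 }\mu\text{ is even},\\[2pt]\Bigl(\sum_{\nu\vdash 2(h-2),\ \nu\text{ even}}c^\mu_{\nu,(2,1,1)}\Bigr)-1&\text{if }\mu\in\mathcal{P}_{2h},\\[2pt]\sum_{\nu\vdash 2(h-2),\ \nu\text{ even}}c^\mu_{\nu,(2,1,1)}&\text{otherwise}.\end{cases}$$ -/

import Mathlib

namespace SymFn

/-- The ring of symmetric functions `Λ = K[p₁, p₂, p₃, …]`; the variable `X r` is the power
sum `p_r`. -/
abbrev Sym (K : Type*) [CommRing K] : Type _ := MvPolynomial ℕ+ K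

section Ring

variable (K : Type*) [CommRing K] [Algebra ℚ K]

/-- The power sum `p_r`. -/
noncomputable def powerSum (r : ℕ+) : Sym K := MvPolynomial.X r

/-- The complete homogeneous symmetric function `h_n`, given in terms of the power sums by
`h_0 = 1` and `n h_n = ∑_{r=1}^{n} p_r h_{n-r}`. -/
noncomputable def complete : ℕ → Sym K
  | 0 => 1
  | n + 1 => ((n + 1 : ℚ)⁻¹) • ∑ i : Fin (n + 1), powerSum K i.val.succPNat * complete (n - i.val)
termination_by n => n
decreasing_by omega

/-- The Schur function `s_μ = det (h_{μ_i - i + j})`, with `h_m = 0` for `m < 0`; the determinant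
has one row for each part of `μ`. -/
noncomputable def schur (μ : YoungDiagram) : Sym K :=
  Matrix.det (Matrix.of fun i j : Fin (μ.colLen 0) =>
    if i.val ≤ μ.rowLen i + j.val then complete K (μ.rowLen i + j.val - i.val) else 0)

variable {K}

/-- The plethysm `p_r[g]` for `g` with rational coefficients: every `p_i` in `g` is replaced by
`p_{r i}`. -/
noncomputable def powerSumPlethysm (K : Type*) [CommRing K] [Algebra ℚ K] (r : ℕ+) (g : Sym ℚ) :
    Sym K :=
  MvPolynomial.aeval (fun i : ℕ+ => powerSum K (r * i)) g

/-- The plethysm `f[g]`: every `p_r` in `f` is replaced by `p_r[g]`. -/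
noncomputable def plethysm (f : Sym K) (g : Sym ℚ) : Sym K :=
  MvPolynomial.aeval (fun r : ℕ+ => powerSumPlethysm K r g) f

end Ring

/-- The number `z_d = ∏_r r ^ (d r) * (d r)!` attached to the partition having `d r` parts equal
to `r`. -/
def zee (d : ℕ+ →₀ ℕ) : ℕ := d.prod fun r m => (r : ℕ) ^ m * m.factorial

/-- The Hall inner product, `⟨p_λ, p_μ⟩ = z_λ` if `λ = μ` and `0` otherwise. -/
noncomputable def hall (f g : Sym ℚ) : ℚ :=
  ∑ d ∈ f.support, (zee d : ℚ) * f.coeff d * g.coeff d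

/-- The Littlewood--Richardson coefficient `c^μ_{ν γ} = ⟨s_μ, s_ν s_γ⟩`. -/
noncomputable def littlewoodRichardson (μ ν γ : YoungDiagram) : ℚ :=
  hall (schur ℚ μ) (schur ℚ ν * schur ℚ γ)

theorem finite_card_eq (n : ℕ) : {μ : YoungDiagram | μ.card = n}.Finite := by
  have hinj : Function.Injective YoungDiagram.cells := fun μ ν h => YoungDiagram.ext h
  refine Set.Finite.of_finite_image (f := YoungDiagram.cells) ?_ hinj.injOn
  refine (Finset.finite_toSet (Finset.range n ×ˢ Finset.range n).powerset).subset ?_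
  rintro _ ⟨μ, hμ, rfl⟩
  simp only [Finset.coe_powerset, Set.mem_preimage, Set.mem_powerset_iff, Finset.coe_subset]
  rintro ⟨i, j⟩ hij
  have hμ' : μ.cells.card = n := hμ
  have hm : (i, j) ∈ μ := hij
  have h1 : i < μ.colLen j := YoungDiagram.mem_iff_lt_colLen.1 hm
  have h2 : j < μ.rowLen i := YoungDiagram.mem_iff_lt_rowLen.1 hm
  have h3 : μ.colLen j ≤ n := by
    rw [YoungDiagram.colLen_eq_card, ← hμ']
    exact Finset.card_le_card (Finset.filter_subset _ _)
  have h4 : μ.rowLen i ≤ n := by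
    rw [YoungDiagram.rowLen_eq_card, ← hμ']
    exact Finset.card_le_card (Finset.filter_subset _ _)
  simp only [Finset.mem_product, Finset.mem_range]
  omega

/-- The finite set of all partitions `μ ⊢ n`. -/
noncomputable def partitionsOf (n : ℕ) : Finset YoungDiagram := (finite_card_eq n).toFinset

theorem mem_partitionsOf {n : ℕ} {μ : YoungDiagram} : μ ∈ partitionsOf n ↔ μ.card = n := by
  simp [partitionsOf]

/-- A partition is even if all of its columns have even length. -/
def IsEven (μ : YoungDiagram) : Prop := ∀ j, Even (μ.colLen j)

/-- All columns have even length, except for exactly two columns, whose lengths are odd and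
distinct. -/
def HasTwoDistinctOddColumns (μ : YoungDiagram) : Prop :=
  ∃ i j, Odd (μ.colLen i) ∧ Odd (μ.colLen j) ∧ μ.colLen i ≠ μ.colLen j ∧
    ∀ k, k ≠ i → k ≠ j → Even (μ.colLen k)

/-- The number `b_μ` of corners of `μ`. -/
def numCorners (μ : YoungDiagram) : ℕ :=
  (μ.cells.filter fun c => (c.1 + 1, c.2) ∉ μ ∧ (c.1, c.2 + 1) ∉ μ).card

theorem sortedGE_hook {h : ℕ} (hh : 3 ≤ h) : [h - 2, 1, 1].SortedGE := by
  rw [List.sortedGE_iff_pairwise]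
  simp
  omega

/-- The partition `(h - 2, 1, 1)`, for `h ≥ 3`. -/
def hook (h : ℕ) (hh : 3 ≤ h) : YoungDiagram := YoungDiagram.ofRowLens [h - 2, 1, 1] (sortedGE_hook hh)

/-- The partition `(2)`. -/
def row2 : YoungDiagram := YoungDiagram.ofRowLens [2] (by decide)

/-- The partition `(1, 1)`. -/
def col2 : YoungDiagram := YoungDiagram.ofRowLens [1, 1] (by decide)

/-- The partition `(2, 1, 1)`. -/
def shape211 : YoungDiagram := YoungDiagram.ofRowLens [2, 1, 1] (by decide)

open Classical in
/-- The sum of `c^μ_{ν (2,1,1)}` over all even partitions `ν ⊢ 2 (h - 2)`. -/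
noncomputable def evenLRSum (h : ℕ) (μ : YoungDiagram) : ℚ :=
  ∑ ν ∈ (partitionsOf (2 * (h - 2))).filter IsEven, littlewoodRichardson μ ν shape211

open Classical in
/-- The coefficient `a_μ` of a partition `μ ⊢ 2 h`. -/
noncomputable def hookCoeff (h : ℕ) (μ : YoungDiagram) : ℚ :=
  if IsEven μ then ((numCorners μ - 1).choose 2 : ℕ)
  else if HasTwoDistinctOddColumns μ then evenLRSum h μ - 1
  else evenLRSum h μ

end SymFn

namespace SymFn

open Finset

/-! Write h_n, e_n for the complete and elementary symmetric functions and H_n = h_n[e_2]. The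
Jacobi–Trudi determinant gives s_{(h-2,1,1)} = h_{h-2} e_2 - h_{h-1} h_1 + h_h. Since f ↦ f[e_2] is
a ring homomorphism and e_2[e_2] = s_{(2,1,1)}, the plethysm with s_{(1,1)} = e_2 is H_{h-2}
s_{(2,1,1)} - H_{h-1} e_2 + H_h (`plethysm_schur_hook`). Its coefficient at s_μ is found by pairing
each term with s_μ.

Littlewood's identity says that H_n is the sum of s_ν over even ν of size 2n
(`hallForm_completePlethysm_schur`). If μ is not even, the last term contributes 0, the first is the
Littlewood–Richardson sum, and the middle one counts the even ν for which μ/ν is a vertical strip of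
size 2. Such a ν exists, and is then unique, exactly when μ has two odd columns, of distinct
lengths. If μ is even, the three pairings are binom(b,2), b and 1, where b is the number of corners,
and binom(b,2) - b + 1 = binom(b-1,2).

The tools are built from the power sums. The adjoints of h_k and e_k are coefficients of the
substitutions p_r ↦ p_r + t^r and p_r ↦ p_r ± t^r, with the sign of an r-cycle
(`hallForm_mul_left`). Applied to determinants they remove horizontal or vertical strips
(`shift_one_schur`, `shift_sgn_schur`). Together with the Pieri rule for h_k s_ν, k ≥ ν_1
(`complete_mul_schur`), this yields orthonormality of the Schur functions by induction, and a
dimension count makes them a basis in each degree (`eq_sum_hallForm_smul_schur`).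

The second formula follows by applying ω, because f[h_2] = ω(f[e_2]) and ω s_μ = s_{μ'}. Everything
is proved over ℚ and then extended to K. -/

/-! ### Young diagrams through their row and column lengths -/

theorem ext_colLen {μ ν : YoungDiagram} (h : ∀ j, μ.colLen j = ν.colLen j) : μ = ν := by
  refine YoungDiagram.ext (Finset.ext fun ⟨i, j⟩ => ?_)
  rw [YoungDiagram.mem_cells, YoungDiagram.mem_cells, YoungDiagram.mem_iff_lt_colLen,
    YoungDiagram.mem_iff_lt_colLen, h]

theorem ext_rowLen {μ ν : YoungDiagram} (h : ∀ i, μ.rowLen i = ν.rowLen i) : μ = ν := by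
  refine YoungDiagram.ext (Finset.ext fun ⟨i, j⟩ => ?_)
  rw [YoungDiagram.mem_cells, YoungDiagram.mem_cells, YoungDiagram.mem_iff_lt_rowLen,
    YoungDiagram.mem_iff_lt_rowLen, h]

theorem le_iff_colLen {μ ν : YoungDiagram} : μ ≤ ν ↔ ∀ j, μ.colLen j ≤ ν.colLen j := by
  constructor
  · intro h j
    by_contra! hlt
    have h1 : (ν.colLen j, j) ∈ μ := YoungDiagram.mem_iff_lt_colLen.2 hlt
    exact lt_irrefl _ (YoungDiagram.mem_iff_lt_colLen.1 (h h1))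
  · rintro h ⟨i, j⟩ hij
    exact YoungDiagram.mem_iff_lt_colLen.2
      ((YoungDiagram.mem_iff_lt_colLen.1 hij).trans_le (h j))

theorem le_iff_rowLen {μ ν : YoungDiagram} : μ ≤ ν ↔ ∀ i, μ.rowLen i ≤ ν.rowLen i := by
  rw [← YoungDiagram.transpose_le_iff, le_iff_colLen]
  simp only [YoungDiagram.colLen_transpose]

theorem card_transpose (μ : YoungDiagram) : μ.transpose.card = μ.card := by
  simp [YoungDiagram.card, YoungDiagram.transpose]

theorem card_eq_sum_colLen {μ : YoungDiagram} {M : ℕ} (hM : μ.rowLen 0 ≤ M) :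
    μ.card = ∑ j ∈ range M, μ.colLen j := by
  have := Finset.card_eq_sum_card_fiberwise (s := μ.cells) (t := range M) (f := Prod.snd) (by
    rintro ⟨i, j⟩ hij
    have h1 : (i, j) ∈ μ := hij
    have h2 := YoungDiagram.mem_iff_lt_rowLen.1 h1
    have h3 := μ.rowLen_anti 0 i (Nat.zero_le _)
    simp only [coe_range, Set.mem_Iio]
    omega)
  rw [YoungDiagram.card, this]
  exact Finset.sum_congr rfl fun j _ => by rw [YoungDiagram.colLen_eq_card, YoungDiagram.col]

theorem card_eq_sum_rowLen {μ : YoungDiagram} {M : ℕ} (hM : μ.colLen 0 ≤ M) :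
    μ.card = ∑ i ∈ range M, μ.rowLen i := by
  rw [← card_transpose, card_eq_sum_colLen (M := M) (by rwa [YoungDiagram.rowLen_transpose])]
  simp only [YoungDiagram.colLen_transpose]

theorem colLen_eq_zero {μ : YoungDiagram} {j : ℕ} (hj : μ.rowLen 0 ≤ j) : μ.colLen j = 0 := by
  by_contra h
  have h1 := YoungDiagram.mem_iff_lt_rowLen.1
    (YoungDiagram.mem_iff_lt_colLen.2 (Nat.pos_of_ne_zero h))
  omega

theorem rowLen_eq_zero {μ : YoungDiagram} {i : ℕ} (hi : μ.colLen 0 ≤ i) : μ.rowLen i = 0 := by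
  rw [← YoungDiagram.colLen_transpose]
  exact colLen_eq_zero (by rwa [YoungDiagram.rowLen_transpose])

theorem colLen_zero_le {μ : YoungDiagram} {N : ℕ} (h : μ.rowLen N = 0) : μ.colLen 0 ≤ N := by
  by_contra! hlt
  have h1 := YoungDiagram.mem_iff_lt_rowLen.1 (YoungDiagram.mem_iff_lt_colLen.2 hlt)
  omega

theorem rowLen_le_card (μ : YoungDiagram) (i : ℕ) : μ.rowLen i ≤ μ.card := by
  rw [YoungDiagram.rowLen_eq_card]
  exact Finset.card_le_card (Finset.filter_subset _ _)

theorem card_mono {μ ν : YoungDiagram} (h : μ ≤ ν) : μ.card ≤ ν.card :=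
  Finset.card_le_card h

theorem eq_of_le_of_card_le {μ ν : YoungDiagram} (h : μ ≤ ν) (hc : ν.card ≤ μ.card) : μ = ν :=
  YoungDiagram.ext (Finset.eq_of_subset_of_card_le h hc)

theorem card_eq_zero_iff {μ : YoungDiagram} : μ.card = 0 ↔ μ = ⊥ := by
  rw [YoungDiagram.card, Finset.card_eq_zero]
  exact ⟨fun h => YoungDiagram.ext (by rw [h]; rfl), fun h => by rw [h]; rfl⟩

/-- The Young diagram with column lengths `f`. -/
def ofCols (f : ℕ → ℕ) (hf : Antitone f) (M : ℕ) : YoungDiagram where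
  cells := (range (f 0) ×ˢ range M).filter fun c => c.1 < f c.2
  isLowerSet := by
    rintro ⟨i, j⟩ ⟨i', j'⟩ hle h
    obtain ⟨hi, hj⟩ : i' ≤ i ∧ j' ≤ j := hle
    simp only [coe_filter, mem_product, mem_range, Set.mem_ofPred_eq] at h ⊢
    have := hf hj
    omega

theorem mem_ofCols {f : ℕ → ℕ} {hf : Antitone f} {M : ℕ} (hM : f M = 0) {i j : ℕ} :
    (i, j) ∈ ofCols f hf M ↔ i < f j := by
  rw [← YoungDiagram.mem_cells]
  simp only [ofCols, mem_filter, mem_product, mem_range]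
  refine ⟨fun h => h.2, fun h => ⟨⟨h.trans_le (hf (Nat.zero_le _)), ?_⟩, h⟩⟩
  by_contra! hj
  have := hf hj
  omega

theorem colLen_ofCols {f : ℕ → ℕ} {hf : Antitone f} {M : ℕ} (hM : f M = 0) (j : ℕ) :
    (ofCols f hf M).colLen j = f j := by
  refine eq_of_forall_lt_iff fun i => ?_
  rw [← YoungDiagram.mem_iff_lt_colLen, mem_ofCols hM]

/-- The Young diagram with row lengths `f`. -/
def ofRows (f : ℕ → ℕ) (hf : Antitone f) (M : ℕ) : YoungDiagram := (ofCols f hf M).transpose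

theorem rowLen_ofRows {f : ℕ → ℕ} {hf : Antitone f} {M : ℕ} (hM : f M = 0) (i : ℕ) :
    (ofRows f hf M).rowLen i = f i := by
  rw [ofRows, YoungDiagram.rowLen_transpose, colLen_ofCols hM]

/-! ### Strips and the parity of columns -/

/-- `μ / ν` is a horizontal strip. -/
def HStrip (ν μ : YoungDiagram) : Prop := ν ≤ μ ∧ ∀ i j, (i + 1, j) ∈ μ → (i, j) ∈ ν

/-- `μ / ν` is a vertical strip. -/
def VStrip (ν μ : YoungDiagram) : Prop := ν ≤ μ ∧ ∀ i j, (i, j + 1) ∈ μ → (i, j) ∈ ν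

theorem hStrip_transpose {ν μ : YoungDiagram} : HStrip ν.transpose μ.transpose ↔ VStrip ν μ := by
  rw [HStrip, VStrip, YoungDiagram.transpose_le_iff]
  simp only [YoungDiagram.mem_transpose, Prod.swap_prod_mk]
  exact and_congr_right fun _ => forall_comm

theorem hStrip_iff_colLen {ν μ : YoungDiagram} :
    HStrip ν μ ↔ ∀ j, ν.colLen j ≤ μ.colLen j ∧ μ.colLen j ≤ ν.colLen j + 1 := by
  rw [HStrip, le_iff_colLen, forall_and]
  refine and_congr_right fun _ => ⟨fun h j => ?_, fun h i j hij => ?_⟩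
  · by_contra! hlt
    have := YoungDiagram.mem_iff_lt_colLen.1 (h _ _ (YoungDiagram.mem_iff_lt_colLen.2 hlt))
    omega
  · rw [YoungDiagram.mem_iff_lt_colLen] at hij ⊢
    have := h j
    omega

theorem vStrip_iff_rowLen {ν μ : YoungDiagram} :
    VStrip ν μ ↔ ∀ i, ν.rowLen i ≤ μ.rowLen i ∧ μ.rowLen i ≤ ν.rowLen i + 1 := by
  rw [← hStrip_transpose, hStrip_iff_colLen]
  simp only [YoungDiagram.colLen_transpose]

theorem hStrip_iff_rowLen {ν μ : YoungDiagram} :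
    HStrip ν μ ↔ ∀ i, ν.rowLen i ≤ μ.rowLen i ∧ μ.rowLen (i + 1) ≤ ν.rowLen i := by
  rw [HStrip, le_iff_rowLen, forall_and]
  refine and_congr_right fun _ => ⟨fun h i => ?_, fun h i j hij => ?_⟩
  · by_contra! hlt
    have := YoungDiagram.mem_iff_lt_rowLen.1 (h _ _ (YoungDiagram.mem_iff_lt_rowLen.2 hlt))
    omega
  · rw [YoungDiagram.mem_iff_lt_rowLen] at hij ⊢
    have := h i
    omega

/-- The number of columns of odd length. -/
def oddCols (μ : YoungDiagram) : ℕ := ∑ j ∈ range (μ.rowLen 0), μ.colLen j % 2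

theorem isEven_iff_mod {μ : YoungDiagram} : IsEven μ ↔ ∀ j, μ.colLen j % 2 = 0 := by
  simp only [IsEven, Nat.even_iff]

theorem isEven_iff_oddCols {μ : YoungDiagram} : IsEven μ ↔ oddCols μ = 0 := by
  rw [isEven_iff_mod, oddCols, Finset.sum_eq_zero_iff]
  refine ⟨fun h j _ => h j, fun h j => ?_⟩
  by_cases hj : μ.rowLen 0 ≤ j
  · rw [colLen_eq_zero hj]
  · exact h j (by simpa using hj)

/-- The diagram obtained by removing the last cell of every odd column. -/
def roundDown (μ : YoungDiagram) : YoungDiagram :=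
  ofCols (fun j => μ.colLen j / 2 * 2) (fun i j hij => by
    have := μ.colLen_anti i j hij
    dsimp only
    omega) (μ.rowLen 0)

theorem colLen_roundDown (μ : YoungDiagram) (j : ℕ) :
    (roundDown μ).colLen j = μ.colLen j / 2 * 2 :=
  colLen_ofCols (by rw [colLen_eq_zero le_rfl]) j

/-- The diagram obtained by adding a cell to every odd column. -/
def roundUp (μ : YoungDiagram) : YoungDiagram :=
  ofCols (fun j => (μ.colLen j + 1) / 2 * 2) (fun i j hij => by
    have := μ.colLen_anti i j hij
    dsimp only
    omega) (μ.rowLen 0)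

theorem colLen_roundUp (μ : YoungDiagram) (j : ℕ) :
    (roundUp μ).colLen j = (μ.colLen j + 1) / 2 * 2 :=
  colLen_ofCols (by rw [colLen_eq_zero le_rfl]) j

theorem rowLen_zero_le {μ : YoungDiagram} {M : ℕ} (h : μ.colLen M = 0) : μ.rowLen 0 ≤ M := by
  rw [← YoungDiagram.colLen_transpose]
  exact colLen_zero_le (by rwa [YoungDiagram.rowLen_transpose])

theorem card_roundDown (μ : YoungDiagram) : (roundDown μ).card + oddCols μ = μ.card := by
  have h : (roundDown μ).rowLen 0 ≤ μ.rowLen 0 :=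
    rowLen_zero_le (by rw [colLen_roundDown, colLen_eq_zero le_rfl])
  rw [card_eq_sum_colLen h, card_eq_sum_colLen le_rfl, oddCols, ← Finset.sum_add_distrib]
  exact Finset.sum_congr rfl fun j _ => by rw [colLen_roundDown]; omega

theorem card_roundUp (μ : YoungDiagram) : (roundUp μ).card = μ.card + oddCols μ := by
  have h : (roundUp μ).rowLen 0 ≤ μ.rowLen 0 :=
    rowLen_zero_le (by rw [colLen_roundUp, colLen_eq_zero le_rfl])
  rw [card_eq_sum_colLen h, card_eq_sum_colLen le_rfl, oddCols, ← Finset.sum_add_distrib]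
  exact Finset.sum_congr rfl fun j _ => by rw [colLen_roundUp]; omega

/-- A horizontal strip has at most one cell in each column, so parity decides which columns lose a
cell. -/
theorem hStrip_isEven_left_iff {ν μ : YoungDiagram} :
    HStrip ν μ ∧ IsEven ν ↔ ν = roundDown μ := by
  constructor
  · rintro ⟨h, he⟩
    refine ext_colLen fun j => ?_
    have h1 := hStrip_iff_colLen.1 h j
    have h2 := isEven_iff_mod.1 he j
    rw [colLen_roundDown]
    omega
  · rintro rfl
    refine ⟨hStrip_iff_colLen.2 fun j => ?_, isEven_iff_mod.2 fun j => ?_⟩ <;>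
    · rw [colLen_roundDown]
      omega

theorem hStrip_isEven_right_iff {ν μ : YoungDiagram} :
    HStrip ν μ ∧ IsEven μ ↔ μ = roundUp ν := by
  constructor
  · rintro ⟨h, he⟩
    refine ext_colLen fun j => ?_
    have h1 := hStrip_iff_colLen.1 h j
    have h2 := isEven_iff_mod.1 he j
    rw [colLen_roundUp]
    omega
  · rintro rfl
    refine ⟨hStrip_iff_colLen.2 fun j => ?_, isEven_iff_mod.2 fun j => ?_⟩ <;>
    · rw [colLen_roundUp]
      omega

theorem oddCols_le_card (μ : YoungDiagram) : oddCols μ ≤ μ.card := by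
  have := card_roundDown μ
  omega

open Classical in
theorem sum_hStrip_isEven_left (μ : YoungDiagram) (n : ℕ) :
    (∑ ν ∈ (partitionsOf n).filter (HStrip · μ), if IsEven ν then (1 : ℚ) else 0) =
      if n + oddCols μ = μ.card then 1 else 0 := by
  rw [← Finset.sum_filter, Finset.filter_filter]
  simp only [hStrip_isEven_left_iff]
  have := card_roundDown μ
  rw [Finset.sum_filter]
  split_ifs with h
  · rw [Finset.sum_eq_single_of_mem (roundDown μ) (mem_partitionsOf.2 (by omega))
      (fun _ _ h => if_neg h), if_pos rfl]
  · refine Finset.sum_eq_zero fun x hx => if_neg ?_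
    rintro rfl
    rw [mem_partitionsOf] at hx
    omega

open Classical in
theorem sum_hStrip_isEven_right (ν : YoungDiagram) (n : ℕ) :
    (∑ μ ∈ (partitionsOf n).filter (HStrip ν ·), if IsEven μ then (1 : ℚ) else 0) =
      if ν.card + oddCols ν = n then 1 else 0 := by
  rw [← Finset.sum_filter, Finset.filter_filter]
  simp only [hStrip_isEven_right_iff]
  have := card_roundUp ν
  rw [Finset.sum_filter]
  split_ifs with h
  · rw [Finset.sum_eq_single_of_mem (roundUp ν) (mem_partitionsOf.2 (by omega))
      (fun _ _ h => if_neg h), if_pos rfl]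
  · refine Finset.sum_eq_zero fun x hx => if_neg ?_
    rintro rfl
    rw [mem_partitionsOf] at hx
    omega

theorem oddCols_add_card_of_hStrip {ν μ : YoungDiagram} (hμ : IsEven μ) (h : HStrip ν μ) :
    ν.card + oddCols ν = μ.card := by
  have h1 : μ = roundUp ν := hStrip_isEven_right_iff.1 ⟨h, hμ⟩
  rw [← card_roundUp, ← h1]

/-- An even diagram containing ν contains `roundUp ν`; the size condition then forces equality. -/
theorem hStrip_of_oddCols {ν μ : YoungDiagram} (hμ : IsEven μ) (hle : ν ≤ μ)
    (h : ν.card + oddCols ν = μ.card) : HStrip ν μ := by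
  have h1 : roundUp ν ≤ μ := by
    refine le_iff_colLen.2 fun j => ?_
    have h1 := le_iff_colLen.1 hle j
    have h2 := isEven_iff_mod.1 hμ j
    rw [colLen_roundUp]
    omega
  have h2 : roundUp ν = μ := eq_of_le_of_card_le h1 (by rw [card_roundUp, h])
  exact (hStrip_isEven_right_iff.2 h2.symm).1

/-! ### Power series with a given logarithmic derivative -/

section Newton

variable {R : Type*} [CommRing R]

/-- `f` is the power series with constant coefficient `1` and logarithmic derivative `Q`. -/
def HasLogDeriv (Q f : PowerSeries R) : Prop :=
  PowerSeries.constantCoeff f = 1 ∧ PowerSeries.derivative R f = Q * f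

theorem HasLogDeriv.mul {Q f Q' g : PowerSeries R} (hf : HasLogDeriv Q f)
    (hg : HasLogDeriv Q' g) : HasLogDeriv (Q + Q') (f * g) := by
  refine ⟨by rw [map_mul, hf.1, hg.1, one_mul], ?_⟩
  rw [Derivation.leibniz, hf.2, hg.2, smul_eq_mul, smul_eq_mul]
  ring

/-- Newton's recurrence is the coefficientwise form of f' = Q f. In the latter form products are
easy: logarithmic derivatives add. -/
theorem hasLogDeriv_mk_iff {Q x : ℕ → R} :
    HasLogDeriv (PowerSeries.mk Q) (PowerSeries.mk x) ↔
      x 0 = 1 ∧ ∀ n : ℕ, ((n : R) + 1) * x (n + 1) = ∑ i ∈ range (n + 1), Q i * x (n - i) := by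
  rw [HasLogDeriv, PowerSeries.ext_iff]
  simp only [← PowerSeries.coeff_zero_eq_constantCoeff_apply, PowerSeries.coeff_mk,
    PowerSeries.coeff_derivative, PowerSeries.coeff_mul]
  refine and_congr_right fun _ => forall_congr' fun n => ?_
  rw [Finset.Nat.sum_antidiagonal_eq_sum_range_succ (fun i j => Q i * x j), mul_comm]

theorem HasLogDeriv.map {S : Type*} [CommRing S] (φ : R →+* S) {Q f : PowerSeries R}
    (hf : HasLogDeriv Q f) : HasLogDeriv (Q.map φ) (f.map φ) := by
  refine ⟨?_, ?_⟩
  · rw [← PowerSeries.coeff_zero_eq_constantCoeff_apply, PowerSeries.coeff_map,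
      PowerSeries.coeff_zero_eq_constantCoeff_apply, hf.1, map_one]
  · rw [← map_mul, ← hf.2]
    ext n
    simp [PowerSeries.coeff_derivative]

/-- The recurrence determines (n+1) times the next coefficient, and n+1 is a unit in a ℚ-algebra.
Identities between generating functions are proved below by comparing logarithmic derivatives. -/
theorem HasLogDeriv.unique [Algebra ℚ R] {Q f g : PowerSeries R} (hf : HasLogDeriv Q f)
    (hg : HasLogDeriv Q g) : f = g := by
  ext n
  induction n using Nat.strong_induction_on with
  | _ n ih =>
    rcases n with _ | n
    · rw [PowerSeries.coeff_zero_eq_constantCoeff_apply, hf.1,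
        PowerSeries.coeff_zero_eq_constantCoeff_apply, hg.1]
    · have h1 := congrArg (PowerSeries.coeff n) hf.2
      have h2 := congrArg (PowerSeries.coeff n) hg.2
      rw [PowerSeries.coeff_derivative, PowerSeries.coeff_mul] at h1 h2
      have h3 : PowerSeries.coeff (n + 1) f * ((n : R) + 1) =
          PowerSeries.coeff (n + 1) g * ((n : R) + 1) := by
        rw [h1, h2]
        refine Finset.sum_congr rfl fun p hp => ?_
        rw [ih p.2 (by rw [Finset.HasAntidiagonal.mem_antidiagonal] at hp; omega)]
      have hu : IsUnit ((n : R) + 1) := by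
        have : IsUnit (algebraMap ℚ R ((n : ℚ) + 1)) :=
          (IsUnit.mk0 _ (by positivity)).map _
        simpa using this
      exact hu.mul_right_cancel h3

end Newton

/-! ### Complete symmetric functions: generating function, base change, degree -/

theorem complete_zero (K : Type*) [CommRing K] [Algebra ℚ K] : complete K 0 = 1 := by
  rw [complete]

theorem hasLogDeriv_complete (K : Type*) [CommRing K] [Algebra ℚ K] :
    HasLogDeriv (PowerSeries.mk fun i : ℕ => powerSum K i.succPNat)
      (PowerSeries.mk (complete K)) := by
  refine hasLogDeriv_mk_iff.2 ⟨complete_zero K, fun n => ?_⟩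
  rw [complete, ← Fin.sum_univ_eq_sum_range (fun i => powerSum K i.succPNat * complete K (n - i))]
  have h : ((n : Sym K) + 1) = algebraMap ℚ (Sym K) ((n : ℚ) + 1) := by simp
  rw [h, ← Algebra.smul_def, smul_smul, mul_inv_cancel₀ (by positivity), one_smul]

theorem complete_one (K : Type*) [CommRing K] [Algebra ℚ K] : complete K 1 = powerSum K 1 := by
  have h := (hasLogDeriv_mk_iff.1 (hasLogDeriv_complete K)).2 0
  have h' : complete K 1 = powerSum K (Nat.succPNat 0) := by simpa [complete_zero] using h
  exact h'

theorem map_complete (K : Type*) [CommRing K] [Algebra ℚ K] (n : ℕ) :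
    MvPolynomial.map (algebraMap ℚ K) (complete ℚ n) = complete K n := by
  have h1 := (hasLogDeriv_complete ℚ).map
    (MvPolynomial.map (σ := ℕ+) (algebraMap ℚ K))
  have h2 : (PowerSeries.mk fun i : ℕ => powerSum ℚ i.succPNat).map
      (MvPolynomial.map (σ := ℕ+) (algebraMap ℚ K)) =
      PowerSeries.mk fun i : ℕ => powerSum K i.succPNat := by
    ext1 n
    simp [powerSum]
  rw [h2] at h1
  have h3 := congrArg (PowerSeries.coeff n) (h1.unique (hasLogDeriv_complete K))
  simpa using h3

/-- The weight of `p_r` is `r`. -/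
def wt (r : ℕ+) : ℕ := r

theorem homogeneous_of_hasLogDeriv {Q x : ℕ → Sym ℚ} {e : ℕ}
    (h : HasLogDeriv (PowerSeries.mk Q) (PowerSeries.mk x))
    (hQ : ∀ n, (Q n).IsWeightedHomogeneous wt (e * (n + 1))) (n : ℕ) :
    (x n).IsWeightedHomogeneous wt (e * n) := by
  obtain ⟨h0, hs⟩ := hasLogDeriv_mk_iff.1 h
  induction n using Nat.strong_induction_on with
  | _ n ih =>
    rcases n with _ | n
    · rw [h0]
      exact MvPolynomial.isWeightedHomogeneous_one ℚ wt
    · have h1 : x (n + 1) = MvPolynomial.C ((n + 1 : ℚ)⁻¹) *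
          ∑ i ∈ range (n + 1), Q i * x (n - i) := by
        rw [← hs n]
        have h2 : ((n : Sym ℚ) + 1) = MvPolynomial.C ((n : ℚ) + 1) := by simp
        rw [h2, ← mul_assoc, ← MvPolynomial.C_mul, inv_mul_cancel₀ (by positivity),
          MvPolynomial.C_1, one_mul]
      rw [h1, ← zero_add (e * (n + 1))]
      refine (MvPolynomial.isWeightedHomogeneous_C wt _).mul
        (MvPolynomial.IsWeightedHomogeneous.sum _ _ _ fun i hi => ?_)
      have hi' : i ≤ n := by simpa [Nat.lt_succ_iff] using hi
      have h3 := (hQ i).mul (ih (n - i) (by omega))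
      rwa [← mul_add, show i + 1 + (n - i) = n + 1 by omega] at h3

theorem homogeneous_complete (n : ℕ) : (complete ℚ n).IsWeightedHomogeneous wt n := by
  have h := homogeneous_of_hasLogDeriv (e := 1) (hasLogDeriv_complete ℚ) (fun n => by
    have := MvPolynomial.isWeightedHomogeneous_X ℚ wt n.succPNat
    rwa [one_mul]) n
  rwa [one_mul] at h

/-! ### Shifting the power sums -/

section Shift

open Polynomial

/-- The homomorphism replacing `p_r` by `p_r + w_r t ^ r`. -/
noncomputable def shift (w : ℕ+ → ℚ) : Sym ℚ →ₐ[ℚ] Polynomial (Sym ℚ) :=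
  MvPolynomial.aeval fun r : ℕ+ =>
    C (MvPolynomial.X r) + C (MvPolynomial.C (w r)) * X ^ (r : ℕ)

theorem shift_X (w : ℕ+ → ℚ) (r : ℕ+) : shift w (MvPolynomial.X r) =
    C (MvPolynomial.X r) + C (MvPolynomial.C (w r)) * X ^ (r : ℕ) :=
  MvPolynomial.aeval_X _ _

theorem shift_C (w : ℕ+ → ℚ) (a : ℚ) : shift w (MvPolynomial.C a) = C (MvPolynomial.C a) :=
  MvPolynomial.aeval_C _ _

/-- The coefficient of `t ^ k` in `shift w`. -/
noncomputable def perp (w : ℕ+ → ℚ) (k : ℕ) : Sym ℚ →ₗ[ℚ] Sym ℚ :=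
  ((Polynomial.lcoeff (Sym ℚ) k).restrictScalars ℚ).comp (shift w).toLinearMap

theorem perp_apply (w : ℕ+ → ℚ) (k : ℕ) (f : Sym ℚ) : perp w k f = (shift w f).coeff k := rfl

theorem perp_zero (w : ℕ+ → ℚ) (f : Sym ℚ) : perp w 0 f = f := by
  have h : ((Polynomial.constantCoeff (R := Sym ℚ)).comp (shift w).toRingHom) = RingHom.id _ := by
    refine MvPolynomial.ringHom_ext (fun a => ?_) fun r => ?_
    · simp
    · simp [shift_X, Polynomial.coeff_X_pow, r.pos.ne]
  exact congrArg (fun φ : Sym ℚ →+* Sym ℚ => φ f) h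

/-- This is the chain rule t d/dt F(p_r + w_r t^r) = ∑ r w_r t^r (∂F/∂p_r)(p_r + w_r t^r), with r =
i + 1. Truncation modulo t^(N+1) keeps the sum finite. Both sides obey the Leibniz rule, so only
constants and single variables need checking. -/
theorem X_pow_dvd_shift (w : ℕ+ → ℚ) (N : ℕ) (f : Sym ℚ) :
    (X : Polynomial (Sym ℚ)) ^ (N + 1) ∣ X * derivative (shift w f) -
      ∑ i ∈ range N, C (MvPolynomial.C (((i : ℚ) + 1) * w i.succPNat)) * X ^ (i + 1) *
        shift w (MvPolynomial.pderiv i.succPNat f) := by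
  induction f using MvPolynomial.induction_on with
  | C a => simp
  | add f g hf hg =>
    convert dvd_add hf hg using 1
    simp only [map_add, mul_add, Finset.sum_add_distrib]
    ring
  | mul_X f s hf =>
    have hX : (X : Polynomial (Sym ℚ)) ^ (N + 1) ∣ X * derivative (shift w (MvPolynomial.X s)) -
      ∑ i ∈ range N, C (MvPolynomial.C (((i : ℚ) + 1) * w i.succPNat)) * X ^ (i + 1) *
        shift w (MvPolynomial.pderiv i.succPNat (MvPolynomial.X s)) := by
      obtain ⟨m, rfl⟩ : ∃ m : ℕ, s = m.succPNat := ⟨s.natPred, (PNat.succPNat_natPred s).symm⟩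
      have h1 : X * derivative (shift w (MvPolynomial.X m.succPNat)) =
          C (MvPolynomial.C (((m : ℚ) + 1) * w m.succPNat)) * X ^ (m + 1) := by
        rw [shift_X]
        simp only [derivative_add, derivative_C, zero_add, derivative_C_mul_X_pow,
          Nat.succPNat_coe, Nat.succ_eq_add_one, Nat.add_sub_cancel]
        rw [mul_left_comm, ← pow_succ', MvPolynomial.C_mul]
        simp [mul_comm]
      have h2 : ∀ i, shift w (MvPolynomial.pderiv i.succPNat
          (MvPolynomial.X m.succPNat)) = if i = m then 1 else 0 := by
        intro i
        rw [MvPolynomial.pderiv_X]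
        by_cases h : i = m
        · subst h
          simp
        · rw [if_neg h, Pi.single_eq_of_ne (fun h' => h (Nat.succPNat_injective h').symm |>.elim)]
          simp
      simp only [h1, h2, mul_ite, mul_one, mul_zero, Finset.sum_ite_eq', mem_range]
      split_ifs with h
      · rw [sub_self]
        exact dvd_zero _
      · rw [sub_zero]
        exact (pow_dvd_pow X (by omega)).mul_left _
    convert dvd_add (hf.mul_right (shift w (MvPolynomial.X s))) (hX.mul_left (shift w f)) using 1
    have e : ∀ i : ℕ, C (MvPolynomial.C (((i : ℚ) + 1) * w i.succPNat)) * X ^ (i + 1) *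
        shift w (MvPolynomial.pderiv i.succPNat (f * MvPolynomial.X s)) =
        C (MvPolynomial.C (((i : ℚ) + 1) * w i.succPNat)) * X ^ (i + 1) *
          shift w (MvPolynomial.pderiv i.succPNat f) * shift w (MvPolynomial.X s) +
        shift w f * (C (MvPolynomial.C (((i : ℚ) + 1) * w i.succPNat)) * X ^ (i + 1) *
          shift w (MvPolynomial.pderiv i.succPNat (MvPolynomial.X s))) := by
      intro i
      rw [Derivation.leibniz, smul_eq_mul, smul_eq_mul, map_add, map_mul (shift w),
        map_mul (shift w)]
      ring
    rw [Finset.sum_congr rfl fun i _ => e i, Finset.sum_add_distrib, ← Finset.sum_mul,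
      ← Finset.mul_sum, map_mul, derivative_mul]
    ring

/-- The coefficient of t^(n+1) in the chain rule. It mirrors Newton's recurrence, with p_r replaced
by r ∂/∂p_r. -/
theorem perp_succ (w : ℕ+ → ℚ) (n : ℕ) (f : Sym ℚ) :
    ((n : ℚ) + 1) • perp w (n + 1) f = ∑ i ∈ range (n + 1),
      (((i : ℚ) + 1) * w i.succPNat) • perp w (n - i) (MvPolynomial.pderiv i.succPNat f) := by
  have h := Polynomial.X_pow_dvd_iff.1 (X_pow_dvd_shift w (n + 1) f) (n + 1) (Nat.lt_succ_self _)
  rw [coeff_sub, coeff_X_mul, coeff_derivative, finsetSum_coeff, sub_eq_zero] at h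
  rw [perp_apply, MvPolynomial.smul_eq_C_mul]
  rw [mul_comm]
  convert h using 1
  · simp
  · refine Finset.sum_congr rfl fun i hi => ?_
    have hi' : i ≤ n := by simpa [Nat.lt_succ_iff] using hi
    rw [mul_assoc, coeff_C_mul, coeff_X_pow_mul', if_pos (by omega), perp_apply,
      MvPolynomial.smul_eq_C_mul, show n + 1 - (i + 1) = n - i by omega]

theorem perp_pderiv (w : ℕ+ → ℚ) (k : ℕ) (r : ℕ+) (f : Sym ℚ) :
    perp w k (MvPolynomial.pderiv r f) = MvPolynomial.pderiv r (perp w k f) := by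
  induction f using MvPolynomial.induction_on generalizing k with
  | C a => simp [perp_apply, Polynomial.coeff_C, apply_ite]
  | add f g hf hg => simp only [map_add, hf, hg]
  | mul_X f s hf =>
    have h : ∀ (g : Sym ℚ) (k : ℕ), perp w k (g * MvPolynomial.X s) = perp w k g * MvPolynomial.X s +
        if (s : ℕ) ≤ k then MvPolynomial.C (w s) * perp w (k - s) g else 0 := by
      intro g k
      simp only [perp_apply, map_mul, shift_X, mul_add, coeff_add, coeff_mul_C]
      rw [mul_left_comm, coeff_C_mul, coeff_mul_X_pow', mul_ite, mul_zero]
    have h1 : ∀ g : Sym ℚ, perp w k (g * MvPolynomial.pderiv r (MvPolynomial.X s)) =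
        perp w k g * MvPolynomial.pderiv r (MvPolynomial.X s) := by
      intro g
      rw [MvPolynomial.pderiv_X]
      by_cases hr : s = r
      · subst hr; simp
      · rw [Pi.single_eq_of_ne hr]; simp
    rw [Derivation.leibniz, smul_eq_mul, smul_eq_mul, map_add, h1, h, Derivation.map_add,
      Derivation.leibniz, smul_eq_mul, smul_eq_mul, mul_comm (MvPolynomial.X s), h, hf]
    split_ifs with hk
    · rw [hf, Derivation.leibniz, MvPolynomial.pderiv_C, smul_zero, smul_eq_mul]
      ring
    · rw [map_zero]
      ring

/-- In `perp_succ` every term involving a positive-order coefficient vanishes; what remains is r w_r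
∂f/∂p_r = 0. -/
theorem pderiv_eq_zero_of_perp {w : ℕ+ → ℚ} (hw : ∀ r, w r ≠ 0) {f : Sym ℚ}
    (h : ∀ k, perp w (k + 1) f = 0) (r : ℕ+) : MvPolynomial.pderiv r f = 0 := by
  obtain ⟨m, rfl⟩ : ∃ m : ℕ, r = m.succPNat := ⟨r.natPred, (PNat.succPNat_natPred r).symm⟩
  have h1 := perp_succ w m f
  rw [h, smul_zero, Finset.sum_range_succ, Finset.sum_eq_zero, zero_add, Nat.sub_self,
    perp_zero] at h1
  · exact (smul_eq_zero.1 h1.symm).resolve_left (mul_ne_zero (by positivity) (hw _))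
  · intro i hi
    rw [mem_range] at hi
    obtain ⟨j, hj⟩ : ∃ j, m - i = j + 1 := ⟨m - i - 1, by omega⟩
    rw [perp_pderiv, hj, h, map_zero, smul_zero]

/-- All partial derivatives vanish, so f is constant in characteristic 0. This permits identities to
be proved by induction on degree, without knowing yet that the Schur functions form a basis. -/
theorem eq_zero_of_perp {w : ℕ+ → ℚ} (hw : ∀ r, w r ≠ 0) {f : Sym ℚ}
    (hf : f.coeff 0 = 0) (h : ∀ k, perp w (k + 1) f = 0) : f = 0 := by
  ext d
  rw [MvPolynomial.coeff_zero]
  by_contra hd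
  have hd0 : d ≠ 0 := by
    rintro rfl
    exact hd hf
  obtain ⟨r, hr⟩ := Finsupp.support_nonempty_iff.2 hd0
  have h1 := congrArg (MvPolynomial.coeff (d - Finsupp.single r 1))
    (pderiv_eq_zero_of_perp hw h r)
  have h2 : d - Finsupp.single r 1 + Finsupp.single r 1 = d := by
    refine tsub_add_cancel_of_le (Finsupp.single_le_iff.2 ?_)
    exact Nat.one_le_iff_ne_zero.2 (Finsupp.mem_support_iff.1 hr)
  rw [MvPolynomial.coeff_pderiv, h2, MvPolynomial.coeff_zero] at h1
  rcases mul_eq_zero.1 h1 with h3 | h3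
  · exact hd h3
  · exact (by positivity : ((d - Finsupp.single r 1 : ℕ+ →₀ ℕ) r : ℚ) + 1 ≠ 0) h3

end Shift

/-! ### The Hall inner product and adjoint operators -/

theorem zee_add_single (d : ℕ+ →₀ ℕ) (r : ℕ+) :
    zee (d + Finsupp.single r 1) = zee d * ((r : ℕ) * (d r + 1)) := by
  have h : ∀ d : ℕ+ →₀ ℕ, zee d = (r : ℕ) ^ d r * (d r).factorial *
      (d.erase r).prod fun r m => (r : ℕ) ^ m * m.factorial := fun d =>
    (Finsupp.mul_prod_erase' d r _ (by simp)).symm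
  rw [h, h d]
  have h1 : (d + Finsupp.single r 1).erase r = d.erase r := by
    rw [Finsupp.erase_add, Finsupp.erase_single, add_zero]
  rw [h1, Finsupp.add_apply, Finsupp.single_eq_same, pow_succ, Nat.factorial_succ]
  ring

theorem hall_eq_sum {f g : Sym ℚ} {S : Finset (ℕ+ →₀ ℕ)} (hS : f.support ⊆ S) :
    hall f g = ∑ d ∈ S, (zee d : ℚ) * f.coeff d * g.coeff d :=
  Finset.sum_subset hS fun d _ hd => by
    rw [MvPolynomial.notMem_support_iff.1 hd, mul_zero, zero_mul]

/-- The Hall inner product as a bilinear form. -/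
noncomputable def hallForm : Sym ℚ →ₗ[ℚ] Sym ℚ →ₗ[ℚ] ℚ :=
  LinearMap.mk₂ ℚ hall
    (fun f f' g => by
      classical
      rw [hall_eq_sum (S := f.support ∪ f'.support) MvPolynomial.support_add,
        hall_eq_sum (f := f) (S := f.support ∪ f'.support) subset_union_left,
        hall_eq_sum (f := f') (S := f.support ∪ f'.support) subset_union_right,
        ← Finset.sum_add_distrib]
      refine Finset.sum_congr rfl fun d _ => ?_
      rw [MvPolynomial.coeff_add]
      ring)
    (fun c f g => by
      rw [hall_eq_sum (f := c • f) (S := f.support) MvPolynomial.support_smul, hall, smul_eq_mul,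
        Finset.mul_sum]
      refine Finset.sum_congr rfl fun d _ => ?_
      rw [MvPolynomial.coeff_smul, smul_eq_mul]
      ring)
    (fun f g g' => by
      rw [hall, hall, hall, ← Finset.sum_add_distrib]
      refine Finset.sum_congr rfl fun d _ => ?_
      rw [MvPolynomial.coeff_add]
      ring)
    (fun c f g => by
      rw [hall, hall, smul_eq_mul, Finset.mul_sum]
      refine Finset.sum_congr rfl fun d _ => ?_
      rw [MvPolynomial.coeff_smul, smul_eq_mul]
      ring)

theorem hallForm_apply (f g : Sym ℚ) : hallForm f g = hall f g := rfl

theorem hallForm_monomial (d : ℕ+ →₀ ℕ) (a : ℚ) (g : Sym ℚ) :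
    hallForm (MvPolynomial.monomial d a) g = (zee d : ℚ) * a * g.coeff d := by
  rw [hallForm_apply, hall_eq_sum (S := {d}) MvPolynomial.support_monomial_subset,
    Finset.sum_singleton, MvPolynomial.coeff_monomial, if_pos rfl]

theorem hallForm_comm (f g : Sym ℚ) : hallForm f g = hallForm g f := by
  classical
  rw [hallForm_apply, hallForm_apply, hall_eq_sum (S := f.support ∪ g.support) subset_union_left,
    hall_eq_sum (f := g) (S := f.support ∪ g.support) subset_union_right]
  exact Finset.sum_congr rfl fun d _ => by ring

/-- On monomials this is z_{d+r} = z_d · r (d_r + 1), the last factor being the one produced by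
differentiation. -/
theorem hallForm_X_mul (r : ℕ+) (f g : Sym ℚ) :
    hallForm (MvPolynomial.X r * f) g = (r : ℚ) * hallForm f (MvPolynomial.pderiv r g) := by
  induction f using MvPolynomial.induction_on' with
  | monomial d a =>
    rw [mul_comm, MvPolynomial.X, MvPolynomial.monomial_mul, mul_one, hallForm_monomial,
      hallForm_monomial, MvPolynomial.coeff_pderiv, zee_add_single]
    push_cast
    ring
  | add f f' hf hf' => rw [mul_add, map_add, map_add, LinearMap.add_apply, LinearMap.add_apply, hf,
      hf', mul_add]

/-- Newton's recurrence for c_k and `perp_succ` correspond term by term under the adjunction between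
p_r and r ∂/∂p_r. The case w = 1 gives the adjoint of h_k, the case w = `sgn` that of e_k = ω h_k.
-/
theorem hallForm_mul_left {w : ℕ+ → ℚ} {c : ℕ → Sym ℚ}
    (hc : HasLogDeriv (PowerSeries.mk fun i : ℕ =>
      MvPolynomial.C (w i.succPNat) * MvPolynomial.X i.succPNat) (PowerSeries.mk c))
    (k : ℕ) (f g : Sym ℚ) : hallForm (c k * f) g = hallForm f (perp w k g) := by
  obtain ⟨h0, hs⟩ := hasLogDeriv_mk_iff.1 hc
  induction k using Nat.strong_induction_on generalizing f g with
  | _ k ih =>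
    rcases k with _ | k
    · rw [h0, one_mul, perp_zero]
    · have h1 : ((k : ℚ) + 1) • (c (k + 1) * f) = ∑ i ∈ range (k + 1),
          w i.succPNat • (MvPolynomial.X i.succPNat * (c (k - i) * f)) := by
        rw [MvPolynomial.smul_eq_C_mul, ← mul_assoc]
        have h2 : ((k : Sym ℚ) + 1) = MvPolynomial.C ((k : ℚ) + 1) := by simp
        rw [← h2, hs, Finset.sum_mul]
        refine Finset.sum_congr rfl fun i _ => ?_
        rw [MvPolynomial.smul_eq_C_mul]
        ring
      have h2 : ((k : ℚ) + 1) • hallForm (c (k + 1) * f) g =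
          ((k : ℚ) + 1) • hallForm f (perp w (k + 1) g) := by
        rw [← LinearMap.smul_apply, ← map_smul, h1, ← map_smul (hallForm f), perp_succ, map_sum,
          map_sum, LinearMap.sum_apply]
        refine Finset.sum_congr rfl fun i _ => ?_
        rw [map_smul, LinearMap.smul_apply, hallForm_X_mul, ih (k - i) (by omega), map_smul,
          smul_eq_mul, smul_eq_mul, Nat.succPNat_coe, Nat.cast_succ]
        ring
      exact smul_right_injective ℚ (by positivity : (k : ℚ) + 1 ≠ 0) h2

/-! ### The involution ω -/

/-- The sign of an `r`-cycle. -/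
def sgn (r : ℕ+) : ℚ := (-1) ^ ((r : ℕ) + 1)

theorem sgn_mul_self (r : ℕ+) : sgn r * sgn r = 1 := by
  rw [sgn, ← mul_pow]
  norm_num

theorem sgn_ne_zero (r : ℕ+) : sgn r ≠ 0 := left_ne_zero_of_mul_eq_one (sgn_mul_self r)

/-- The involution `ω`, given by `ω p_r = (-1) ^ (r - 1) p_r`. -/
noncomputable def omega : Sym ℚ →ₐ[ℚ] Sym ℚ :=
  MvPolynomial.aeval fun r => MvPolynomial.C (sgn r) * MvPolynomial.X r

theorem omega_X (r : ℕ+) :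
    omega (MvPolynomial.X r) = MvPolynomial.C (sgn r) * MvPolynomial.X r :=
  MvPolynomial.aeval_X _ _

theorem omega_C (a : ℚ) : omega (MvPolynomial.C a) = MvPolynomial.C a :=
  MvPolynomial.aeval_C _ _

/-- On generators: sgn_r (p_r + sgn_r t^r) = sgn_r p_r + t^r, since sgn_r² = 1. -/
theorem shift_omega (f : Sym ℚ) :
    shift sgn (omega f) = (shift 1 f).map omega.toRingHom := by
  have h : (shift sgn).toRingHom.comp omega.toRingHom =
      (Polynomial.mapRingHom omega.toRingHom).comp (shift 1).toRingHom := by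
    refine MvPolynomial.ringHom_ext (fun a => ?_) fun r => ?_
    · simp
    · simp only [AlgHom.toRingHom_eq_coe, RingHom.coe_comp, RingHom.coe_coe, Function.comp_apply,
        omega_X, map_mul, shift_X, shift_C, Polynomial.coe_mapRingHom, Polynomial.map_add,
        Polynomial.map_C, Polynomial.map_pow, Polynomial.map_X, Pi.one_apply,
        map_one, one_mul]
      rw [mul_add, ← mul_assoc, ← Polynomial.C_mul, ← Polynomial.C_mul, ← MvPolynomial.C_mul,
        sgn_mul_self]
      simp
  exact congrArg (fun φ : Sym ℚ →+* Polynomial (Sym ℚ) => φ f) h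

theorem perp_omega (k : ℕ) (f : Sym ℚ) : perp sgn k (omega f) = omega (perp 1 k f) := by
  rw [perp_apply, shift_omega, Polynomial.coeff_map]
  rfl

theorem hasLogDeriv_one_complete :
    HasLogDeriv (PowerSeries.mk fun i : ℕ =>
      MvPolynomial.C ((1 : ℕ+ → ℚ) i.succPNat) * MvPolynomial.X i.succPNat)
      (PowerSeries.mk (complete ℚ)) := by
  simpa [powerSum] using hasLogDeriv_complete ℚ

theorem hallForm_complete_mul (k : ℕ) (f g : Sym ℚ) :
    hallForm (complete ℚ k * f) g = hallForm f (perp 1 k g) :=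
  hallForm_mul_left hasLogDeriv_one_complete k f g

theorem hallForm_omega_complete_mul (k : ℕ) (f g : Sym ℚ) :
    hallForm (omega (complete ℚ k) * f) g = hallForm f (perp sgn k g) := by
  refine hallForm_mul_left (c := fun k => omega (complete ℚ k)) ?_ k f g
  have h := (hasLogDeriv_complete ℚ).map omega.toRingHom
  convert h using 1
  · ext1 n
    simp [powerSum, omega_X]
  · ext1 n
    simp

/-! ### The two shifts of h_n -/

/-- The complete symmetric function `h_n`, with `h_n = 0` for `n < 0`. -/
noncomputable def completeInt (n : ℤ) : Sym ℚ := if 0 ≤ n then complete ℚ n.toNat else 0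

theorem completeInt_natCast (n : ℕ) : completeInt n = complete ℚ n := by
  rw [completeInt, if_pos (Int.natCast_nonneg n), Int.toNat_natCast]

theorem completeInt_of_neg {n : ℤ} (hn : n < 0) : completeInt n = 0 := if_neg (not_le.2 hn)

open Polynomial in
-- With z the series variable, this is 1/(1 - Xz), of logarithmic derivative X/(1 - Xz).
theorem hasLogDeriv_X_pow {R : Type*} [CommRing R] :
    HasLogDeriv (PowerSeries.mk fun i : ℕ => (X : R[X]) ^ (i + 1))
      (PowerSeries.mk fun i : ℕ => (X : R[X]) ^ i) := by
  refine hasLogDeriv_mk_iff.2 ⟨pow_zero _, fun n => ?_⟩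
  rw [Finset.sum_congr rfl (g := fun _ => (X : R[X]) ^ (n + 1)) fun i hi => ?_]
  · simp
  · rw [← pow_add]
    rw [mem_range] at hi
    congr 1
    omega

open Polynomial in
-- The series is 1 + Xz, with logarithmic derivative X/(1 + Xz).
theorem hasLogDeriv_sgn {R : Type*} [CommRing R] :
    HasLogDeriv (PowerSeries.mk fun i : ℕ => (-1) ^ i * (X : R[X]) ^ (i + 1))
      (PowerSeries.mk fun i : ℕ => if i = 0 then 1 else if i = 1 then X else 0) := by
  refine hasLogDeriv_mk_iff.2 ⟨rfl, fun n => ?_⟩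
  rcases n with _ | n
  · simp
  · rw [Finset.sum_range_succ, Finset.sum_range_succ, Finset.sum_eq_zero]
    · rw [if_neg (by omega), if_neg (by omega), if_neg (by omega), if_pos (by omega),
        if_pos (by omega)]
      ring
    · intro i hi
      rw [mem_range] at hi
      rw [if_neg (by omega), if_neg (by omega), mul_zero]

open Polynomial in
theorem hasLogDeriv_shift_complete (w : ℕ+ → ℚ) :
    HasLogDeriv ((PowerSeries.mk fun i : ℕ => C (powerSum ℚ i.succPNat)) +
        PowerSeries.mk fun i : ℕ => C (MvPolynomial.C (w i.succPNat)) * X ^ (i + 1))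
      (PowerSeries.mk fun n => shift w (complete ℚ n)) := by
  have h := (hasLogDeriv_complete ℚ).map (shift w).toRingHom
  convert h using 1
  · ext1 n
    simp [powerSum, shift_X]
  · ext1 n
    simp

open Polynomial in
theorem hasLogDeriv_C_complete :
    HasLogDeriv (PowerSeries.mk fun i : ℕ => C (powerSum ℚ i.succPNat))
      (PowerSeries.mk fun n => C (complete ℚ n)) := by
  have h := (hasLogDeriv_complete ℚ).map (C : Sym ℚ →+* (Sym ℚ)[X])
  convert h using 1
  · ext1 n
    simp
  · ext1 n
    simp

open Polynomial in
theorem shift_one_complete_mk : (PowerSeries.mk fun n => shift 1 (complete ℚ n)) =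
    (PowerSeries.mk fun n => C (complete ℚ n)) * PowerSeries.mk fun i : ℕ => X ^ i := by
  refine (hasLogDeriv_shift_complete 1).unique ?_
  convert hasLogDeriv_C_complete.mul hasLogDeriv_X_pow using 2
  ext1 n
  simp

open Polynomial in
theorem shift_sgn_complete_mk : (PowerSeries.mk fun n => shift sgn (complete ℚ n)) =
    (PowerSeries.mk fun n => C (complete ℚ n)) *
      PowerSeries.mk fun i : ℕ => if i = 0 then 1 else if i = 1 then X else 0 := by
  refine (hasLogDeriv_shift_complete sgn).unique ?_
  convert hasLogDeriv_C_complete.mul hasLogDeriv_sgn using 2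
  ext1 n
  simp [sgn, pow_add]

open Polynomial in
theorem shift_one_complete_succ (n : ℕ) : shift 1 (complete ℚ (n + 1)) =
    X * shift 1 (complete ℚ n) + C (complete ℚ (n + 1)) := by
  have h : ∀ n, shift 1 (complete ℚ n) = ∑ i ∈ range (n + 1), C (complete ℚ i) * X ^ (n - i) := by
    intro n
    have := congrArg (PowerSeries.coeff n) shift_one_complete_mk
    rw [PowerSeries.coeff_mul, PowerSeries.coeff_mk,
      Finset.Nat.sum_antidiagonal_eq_sum_range_succ_mk] at this
    simpa only [PowerSeries.coeff_mk] using this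
  rw [h, h, Finset.sum_range_succ, Nat.sub_self, pow_zero, mul_one, Finset.mul_sum,
    add_left_inj]
  refine Finset.sum_congr rfl fun i hi => ?_
  rw [mem_range] at hi
  rw [show n + 1 - i = n - i + 1 by omega, pow_succ]
  ring

open Polynomial in
-- Multiplying the generating function by 1 - tz undoes the shift. Allowing negative indices lets
-- the recurrence act uniformly on every entry of a Jacobi–Trudi matrix.
theorem shift_one_completeInt (n : ℤ) : shift 1 (completeInt n) =
    X * shift 1 (completeInt (n - 1)) + C (completeInt n) := by
  rcases lt_trichotomy n 0 with h | rfl | h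
  · rw [completeInt_of_neg h, completeInt_of_neg (by omega)]
    simp
  · rw [completeInt_of_neg (show (0 : ℤ) - 1 < 0 by omega), completeInt, if_pos le_rfl,
      Int.toNat_zero, complete_zero]
    simp
  · obtain ⟨m, rfl⟩ : ∃ m : ℕ, n = (m : ℤ) + 1 := ⟨(n - 1).toNat, by omega⟩
    rw [add_sub_cancel_right, completeInt_natCast, ← Nat.cast_succ, completeInt_natCast,
      shift_one_complete_succ]

open Polynomial in
theorem shift_sgn_completeInt (n : ℤ) : shift sgn (completeInt n) =
    C (completeInt n) + X * C (completeInt (n - 1)) := by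
  rcases lt_trichotomy n 0 with h | rfl | h
  · rw [completeInt_of_neg h, completeInt_of_neg (by omega)]
    simp
  · rw [completeInt_of_neg (show (0 : ℤ) - 1 < 0 by omega), completeInt, if_pos le_rfl,
      Int.toNat_zero, complete_zero]
    simp
  · obtain ⟨m, rfl⟩ : ∃ m : ℕ, n = (m : ℤ) + 1 := ⟨(n - 1).toNat, by omega⟩
    rw [add_sub_cancel_right, completeInt_natCast, ← Nat.cast_succ, completeInt_natCast]
    have := congrArg (PowerSeries.coeff (m + 1)) shift_sgn_complete_mk
    rw [PowerSeries.coeff_mul, PowerSeries.coeff_mk,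
      Finset.Nat.sum_antidiagonal_eq_sum_range_succ_mk, Finset.sum_range_succ,
      Finset.sum_range_succ, Finset.sum_eq_zero] at this
    · simp only [PowerSeries.coeff_mk] at this
      rw [this, Nat.sub_self, if_pos rfl, if_neg (by omega), if_pos (by omega)]
      simp only [Nat.succ_eq_add_one]
      ring
    · intro i hi
      rw [mem_range] at hi
      simp only [PowerSeries.coeff_mk]
      rw [if_neg (by omega), if_neg (by omega), mul_zero]

/-! ### Expansion of Jacobi–Trudi determinants -/

section Alternating

variable {S M : Type*} [CommRing S] [AddCommGroup M] [Module S M] {N : ℕ}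

/-- Rows are treated from the top down, so that row k+1 is still unchanged when a multiple of it is
subtracted from row k. The last row has only the zero vector A N below it. -/
theorem alternating_sub_smul_succ (f : M [⋀^Fin N]→ₗ[S] S) (A : ℕ → M) (c : ℕ → S)
    (hN : A N = 0) : f (fun i => A i - c i • A (i + 1)) = f fun i => A i := by
  have key : ∀ k ≤ N, f (fun i => if (i : ℕ) < k then A i - c i • A (i + 1) else A i) =
      f fun i => A i := by
    intro k
    induction k with
    | zero => intro _; simp
    | succ k ih =>
      intro hk
      rw [← ih (by omega)]
      set B : Fin N → M := fun i => if (i : ℕ) < k then A i - c i • A (i + 1) else A i with hB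
      have h1 : (fun i : Fin N => if (i : ℕ) < k + 1 then A i - c i • A (i + 1) else A i) =
          Function.update B ⟨k, hk⟩ (A k - c k • A (k + 1)) := by
        funext i
        by_cases hi : i = ⟨k, hk⟩
        · subst hi
          simp
        · rw [Function.update_of_ne hi, hB]
          have : (i : ℕ) ≠ k := fun h => hi (Fin.ext h)
          exact if_congr (by omega) rfl rfl
      have h2 : Function.update B ⟨k, hk⟩ (A k) = B := by
        rw [Function.update_eq_self_iff, hB]
        simp
      have h3 : f (Function.update B ⟨k, hk⟩ (A (k + 1))) = 0 := by
        rcases Nat.lt_or_ge (k + 1) N with h | h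
        · have h4 : A (k + 1) = B ⟨k + 1, h⟩ := by rw [hB]; simp
          rw [h4]
          exact f.map_update_self B (by simp [Fin.ext_iff])
        · rw [show k + 1 = N by omega, hN]
          exact f.map_update_zero B _
      rw [h1, AlternatingMap.map_update_sub, AlternatingMap.map_update_smul, h2, h3, smul_zero,
        sub_zero]
  rw [← key N le_rfl]
  congr 1
  funext i
  rw [if_pos i.2]

theorem telescope_Ioc (t : S) (g v : ℤ → M) (hg : ∀ n, g n = t • g (n - 1) + v n) {a b : ℤ}
    (hab : b ≤ a) :
    g a - t ^ (a - b).toNat • g b = ∑ x ∈ Ioc b a, t ^ (a - x).toNat • v x := by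
  induction a, hab using Int.leInduction with
  | base => simp
  | succ a hab ih =>
    have h1 : Ioc b (a + 1) = insert (a + 1) (Ioc b a) := by
      ext x
      simp only [mem_Ioc, mem_insert]
      omega
    have h2 : ∀ x ≤ a, (a + 1 - x).toNat = (a - x).toNat + 1 := by intro x hx; omega
    rw [h1, Finset.sum_insert (by simp), sub_self, Int.toNat_zero, pow_zero, one_smul,
      Finset.sum_congr rfl (g := fun x => t • (t ^ (a - x).toNat • v x)), ← Finset.smul_sum, ← ih,
      hg (a + 1), h2 b hab, add_sub_cancel_right, pow_succ', smul_sub, smul_smul]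
    · abel
    · intro x hx
      rw [h2 x (mem_Ioc.1 hx).2, pow_succ', smul_smul]

/-- Unrolled, each row g(a_i) is a t-weighted tail of the v's. Subtracting t^(a_i - a_{i+1}) times
the next row cuts the tail to the window (a_{i+1}, a_i]. Multilinearity then gives a sum over
interlacing sequences directly, with no cancellation left to perform. -/
theorem alternating_interlace (f : M [⋀^Fin N]→ₗ[S] S) (t : S) (g v : ℤ → M)
    (hg : ∀ n, g n = t • g (n - 1) + v n) (a : ℕ → ℤ) (ha : ∀ i, a (i + 1) ≤ a i)
    (hN : g (a N) = 0) :
    f (fun i => g (a i)) = ∑ b ∈ Fintype.piFinset fun i : Fin N => Ioc (a (i + 1)) (a i),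
      t ^ (∑ i : Fin N, (a i - b i).toNat) * f fun i => v (b i) := by
  rw [← alternating_sub_smul_succ f (fun i => g (a i))
    (fun i => t ^ (a i - a (i + 1)).toNat) hN]
  have h1 : (fun i : Fin N => g (a i) - t ^ (a i - a (i + 1)).toNat • g (a (i + 1))) =
      fun i : Fin N => ∑ x ∈ Ioc (a (i + 1)) (a i), t ^ (a i - x).toNat • v x := by
    funext i
    exact telescope_Ioc t g v hg (ha i)
  rw [h1]
  have h2 := f.toMultilinearMap.map_sum_finset (fun (i : Fin N) x => t ^ (a i - x).toNat • v x)
    (fun i => Ioc (a (i + 1)) (a i))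
  rw [AlternatingMap.coe_multilinearMap] at h2
  rw [h2]
  refine Finset.sum_congr rfl fun b _ => ?_
  have h3 := f.toMultilinearMap.map_smul_univ (fun i : Fin N => t ^ (a i - b i).toNat)
    (fun i => v (b i))
  rw [AlternatingMap.coe_multilinearMap] at h3
  rw [h3, Finset.prod_pow_eq_pow_sum, smul_eq_mul]

end Alternating

/-- The Jacobi--Trudi determinant `det (h_{a_i + j})`. -/
noncomputable def jt (N : ℕ) (a : Fin N → ℤ) : Sym ℚ :=
  Matrix.det (Matrix.of fun i c : Fin N => completeInt (a i + c))

open Polynomial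

theorem shift_one_jt (N : ℕ) (a : ℕ → ℤ) (ha : ∀ i, a (i + 1) ≤ a i) (hN : a N = -N) :
    shift 1 (jt N fun i => a i) =
      ∑ b ∈ Fintype.piFinset fun i : Fin N => Ioc (a (i + 1)) (a i),
        X ^ (∑ i : Fin N, (a i - b i).toNat) * C (jt N b) := by
  have h := alternating_interlace
    (Matrix.detRowAlternating : (Fin N → (Sym ℚ)[X]) [⋀^Fin N]→ₗ[(Sym ℚ)[X]] (Sym ℚ)[X]) X
    (fun n c => shift 1 (completeInt (n + c))) (fun n c => C (completeInt (n + c)))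
    (fun n => by
      funext c
      simp only [Pi.add_apply, Pi.smul_apply, smul_eq_mul]
      rw [shift_one_completeInt, show n + (c : ℤ) - 1 = n - 1 + c by ring]) a ha (by
      funext c
      -- The virtual row after the last one has entries h_{c-N} with c < N, all zero.
      rw [hN, completeInt_of_neg (by have := c.2; omega), map_zero]
      rfl)
  have h1 : ∀ (φ : Sym ℚ →+* (Sym ℚ)[X]) (b : Fin N → ℤ),
      Matrix.detRowAlternating (fun (i c : Fin N) => φ (completeInt (b i + c))) = φ (jt N b) :=
    fun φ b => by
      rw [jt, RingHom.map_det]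
      rfl
  have h2 := h1 (shift 1).toRingHom fun i => a i
  refine h2.symm.trans (h.trans (Finset.sum_congr rfl fun b _ => ?_))
  rw [h1]

/-- The linear map `t ^ j ↦ h_{k + j}`. -/
noncomputable def evalComplete (k : ℤ) : (Sym ℚ)[X] →ₗ[Sym ℚ] Sym ℚ :=
  Polynomial.lsum fun n => LinearMap.id.smulRight (completeInt (k + n))

theorem evalComplete_C_mul_X_pow (k : ℤ) (a : Sym ℚ) (n : ℕ) :
    evalComplete k (C a * X ^ n) = a * completeInt (k + n) := by
  rw [evalComplete, Polynomial.lsum_apply, C_mul_X_pow_eq_monomial, Polynomial.sum_monomial_index]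
  all_goals simp

/-- Expansion along the top row: the determinant is linear in the powers of t there, and the other
rows are free of t. -/
theorem evalComplete_det (k : ℤ) (N m : ℕ) (w : Fin N → Fin (N + 1) → Sym ℚ) :
    evalComplete k (X ^ m * Matrix.det (Matrix.of (Matrix.vecCons
      (fun c : Fin (N + 1) => (X : (Sym ℚ)[X]) ^ (c : ℕ)) fun i c => C (w i c)))) =
    Matrix.det (Matrix.of (Matrix.vecCons (fun c : Fin (N + 1) => completeInt (k + m + c)) w)) := by
  rw [Matrix.det_succ_row_zero, Matrix.det_succ_row_zero, Finset.mul_sum, map_sum]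
  refine Finset.sum_congr rfl fun c _ => ?_
  have h1 : ((Matrix.of (Matrix.vecCons (fun c : Fin (N + 1) => (X : (Sym ℚ)[X]) ^ (c : ℕ))
      fun i c => C (w i c))).submatrix Fin.succ c.succAbove) =
      (C : Sym ℚ →+* (Sym ℚ)[X]).mapMatrix ((Matrix.of (Matrix.vecCons
        (fun c : Fin (N + 1) => completeInt (k + m + c)) w)).submatrix Fin.succ c.succAbove) := by
    ext i j
    simp
  rw [h1, ← RingHom.map_det]
  set d := Matrix.det ((Matrix.of (Matrix.vecCons
        (fun c : Fin (N + 1) => completeInt (k + m + c)) w)).submatrix Fin.succ c.succAbove)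
  have h2 : (X : (Sym ℚ)[X]) ^ m * ((-1) ^ (c : ℕ) * (Matrix.of (Matrix.vecCons
      (fun c : Fin (N + 1) => (X : (Sym ℚ)[X]) ^ (c : ℕ)) fun i c => C (w i c))) 0 c * C d) =
      C ((-1) ^ (c : ℕ) * d) * X ^ (m + c) := by
    simp only [Matrix.of_apply, Matrix.cons_val_zero, C_mul, C_pow, C_neg, C_1, pow_add]
    ring
  rw [h2, evalComplete_C_mul_X_pow]
  simp only [Matrix.of_apply, Matrix.cons_val_zero, Nat.cast_add, add_assoc]
  ring

/-- A top row (1, t, ..., t^N) is added above the shifted rows. Computed by column operations, the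
determinant is the original one; computed by `alternating_interlace`, it is a sum over interlacing
sequences. Sending t^j to h_{k+j} then turns the first value into h_k times the determinant and
fills the top rows in the sum with complete functions. -/
theorem complete_mul_jt (k : ℤ) (N : ℕ) (a : ℕ → ℤ) (ha : ∀ i, a (i + 1) ≤ a i)
    (hN : a N = -N) :
    completeInt k * jt N (fun i => a i) =
      ∑ b ∈ Fintype.piFinset fun i : Fin N => Ioc (a (i + 1)) (a i),
        jt (N + 1) (Fin.cons (k + (∑ i : Fin N, (a i - b i).toNat : ℕ)) fun i => b i - 1) := by
  have h := alternating_interlace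
    ((Matrix.detRowAlternating : (Fin (N + 1) → (Sym ℚ)[X]) [⋀^Fin (N + 1)]→ₗ[(Sym ℚ)[X]]
      (Sym ℚ)[X]).curryLeft fun c => X ^ (c : ℕ)) X
    (fun n c => shift 1 (completeInt (n - 1 + c))) (fun n c => C (completeInt (n - 1 + c)))
    (fun n => by
      funext c
      simp only [Pi.add_apply, Pi.smul_apply, smul_eq_mul]
      rw [shift_one_completeInt, show n - 1 + (c : ℤ) - 1 = n - 1 - 1 + c by ring]) a ha (by
      funext c
      rw [hN, completeInt_of_neg (by have := c.2; omega), map_zero]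
      rfl)
  have h1 : ((Matrix.detRowAlternating : (Fin (N + 1) → (Sym ℚ)[X]) [⋀^Fin (N + 1)]→ₗ[(Sym ℚ)[X]]
      (Sym ℚ)[X]).curryLeft fun c => X ^ (c : ℕ))
      (fun i c => shift 1 (completeInt (a i - 1 + c))) = C (jt N fun i => a i) := by
    -- Subtracting t times the preceding column turns the top row into (1, 0, ..., 0) and, by the
    -- recurrence for the shift, frees the remaining minor of t.
    have h2 := Matrix.det_eq_of_forall_col_eq_smul_add_pred
      (A := Matrix.of (Matrix.vecCons (fun c : Fin (N + 1) => (X : (Sym ℚ)[X]) ^ (c : ℕ))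
        fun (i : Fin N) (c : Fin (N + 1)) => shift 1 (completeInt (a i - 1 + c))))
      (B := Matrix.of (Matrix.vecCons (fun c : Fin (N + 1) => if c = 0 then (1 : (Sym ℚ)[X]) else 0)
        fun (i : Fin N) (c : Fin (N + 1)) => if c = 0 then shift 1 (completeInt (a i - 1)) else
          C (completeInt (a i - 1 + c)))) (fun _ => X)
      (fun i => by
        refine Fin.cases ?_ (fun i => ?_) i
        · simp
        · simp)
      (fun i j => by
        refine Fin.cases ?_ (fun i => ?_) i
        · simp [pow_succ', Fin.succ_ne_zero]
        · simp only [Matrix.of_apply, Matrix.cons_val_succ, Fin.succ_ne_zero, if_false]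
          rw [shift_one_completeInt, add_comm, Fin.val_succ, Fin.val_castSucc]
          push_cast
          rw [show a i - 1 + ((j : ℤ) + 1) - 1 = a i - 1 + j by ring])
    refine h2.trans ?_
    rw [Matrix.det_succ_row_zero, Finset.sum_eq_single 0]
    · rw [jt, RingHom.map_det]
      simp only [Fin.val_zero, pow_zero, one_mul, Matrix.of_apply, Matrix.cons_val_zero, if_true]
      congr 1
      ext1 i j
      simp [Fin.succ_ne_zero]
    · intro c _ hc
      simp [hc]
    · simp
  have h3 := congrArg (evalComplete k) (h1.symm.trans h)
  rw [map_sum] at h3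
  have h4 := evalComplete_C_mul_X_pow k (jt N fun i => a i) 0
  rw [pow_zero, mul_one, Nat.cast_zero, add_zero, mul_comm] at h4
  rw [← h4, h3]
  refine Finset.sum_congr rfl fun b _ => ?_
  refine (evalComplete_det k N _ fun i c => completeInt (b i - 1 + c)).trans ?_
  rw [jt]
  congr 1
  ext1 i j
  refine Fin.cases ?_ (fun i => ?_) i
  · simp
  · simp

/-- The shift of h_n is h_n + t h_{n-1}, so every row is a sum of two; the set s records the rows
from which the lowered summand is taken. -/
theorem shift_sgn_jt (N : ℕ) (a : Fin N → ℤ) :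
    shift sgn (jt N a) = ∑ s : Finset (Fin N),
      X ^ s.card * C (jt N fun i => a i - if i ∈ s then 1 else 0) := by
  have h1 : ∀ (φ : Sym ℚ →+* (Sym ℚ)[X]) (b : Fin N → ℤ),
      Matrix.detRowAlternating (fun (i c : Fin N) => φ (completeInt (b i + c))) = φ (jt N b) :=
    fun φ b => by
      rw [jt, RingHom.map_det]
      rfl
  have h2 := h1 (shift sgn).toRingHom a
  refine h2.symm.trans ?_
  have h3 : (fun (i c : Fin N) => (shift sgn).toRingHom (completeInt (a i + c))) =
      (fun i : Fin N => (X : (Sym ℚ)[X]) • fun c : Fin N => C (completeInt (a i - 1 + c))) +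
      fun i c : Fin N => C (completeInt (a i + c)) := by
    funext i c
    simp only [Pi.add_apply, Pi.smul_apply, smul_eq_mul]
    rw [add_comm (X * _), show a i - 1 + (c : ℤ) = a i + c - 1 by ring]
    exact shift_sgn_completeInt _
  rw [h3]
  have h4 := (Matrix.detRowAlternating : (Fin N → (Sym ℚ)[X]) [⋀^Fin N]→ₗ[(Sym ℚ)[X]]
    (Sym ℚ)[X]).toMultilinearMap.map_add_univ
    (fun i : Fin N => (X : (Sym ℚ)[X]) • fun c : Fin N => C (completeInt (a i - 1 + c)))
      (fun i c : Fin N => C (completeInt (a i + c)))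
  rw [AlternatingMap.coe_multilinearMap] at h4
  rw [h4]
  refine Finset.sum_congr rfl fun s _ => ?_
  rw [← h1]
  have h5 := (Matrix.detRowAlternating : (Fin N → (Sym ℚ)[X]) [⋀^Fin N]→ₗ[(Sym ℚ)[X]]
    (Sym ℚ)[X]).toMultilinearMap.map_smul_univ (fun i => if i ∈ s then X else 1)
    (fun i c : Fin N => C (completeInt (a i - (if i ∈ s then 1 else 0) + c)))
  rw [AlternatingMap.coe_multilinearMap, Finset.prod_ite_mem, univ_inter, Finset.prod_const,
    smul_eq_mul] at h5
  rw [← h5]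
  congr 1
  funext i
  by_cases hi : i ∈ s
  · simp [hi]
  · simp [hi]

/-- The extra row is (0, ..., 0, 1). Hence a Schur function may be computed with any number of rows
at least the length of its diagram. -/
theorem jt_succ (N : ℕ) (a : ℕ → ℤ) (hN : a N = -N) :
    jt (N + 1) (fun i => a i) = jt N fun i => a i := by
  rw [jt, Matrix.det_succ_row _ (Fin.last N), Finset.sum_eq_single (Fin.last N)]
  · rw [Matrix.of_apply, Fin.val_last, hN, neg_add_cancel, ← Nat.cast_zero, completeInt_natCast,
      complete_zero, ← two_mul, pow_mul, neg_one_sq, one_pow, one_mul, one_mul, jt]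
    congr 1
    ext1 i j
    simp [Fin.succAbove_last]
  · intro c _ hc
    have h1 : (c : ℕ) < N := Fin.val_lt_last hc
    rw [Matrix.of_apply, Fin.val_last, hN, completeInt_of_neg (by omega), mul_zero, zero_mul]
  · simp

theorem schur_eq_jt {μ : YoungDiagram} {N : ℕ} (hN : μ.colLen 0 ≤ N) :
    schur ℚ μ = jt N fun i => (μ.rowLen i : ℤ) - i := by
  induction N, hN using Nat.le_induction with
  | base =>
    rw [schur, jt]
    congr 1
    ext1 i j
    simp only [Matrix.of_apply]
    split_ifs with h
    · rw [← completeInt_natCast]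
      congr 1
      omega
    · rw [completeInt_of_neg (by omega)]
  | succ N hN ih =>
    rw [ih, jt_succ N (fun i => (μ.rowLen i : ℤ) - i) (by rw [rowLen_eq_zero hN]; simp)]

theorem homogeneous_schur (μ : YoungDiagram) : (schur ℚ μ).IsWeightedHomogeneous wt μ.card := by
  rw [schur_eq_jt le_rfl, jt, Matrix.det_apply, ← MvPolynomial.mem_weightedHomogeneousSubmodule]
  refine Submodule.sum_mem _ fun σ _ => ?_
  rw [Units.smul_def]
  refine zsmul_mem ?_ _
  rw [MvPolynomial.mem_weightedHomogeneousSubmodule]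
  simp only [Matrix.of_apply]
  set e : Fin (μ.colLen 0) → ℤ := fun i => (μ.rowLen (σ i) : ℤ) - (σ i : ℕ) + (i : ℕ) with he
  by_cases h : ∀ i, 0 ≤ e i
  · have h1 : ∑ i, (e i).toNat = μ.card := by
      zify
      rw [Finset.sum_congr rfl fun i _ => Int.toNat_of_nonneg (h i), he, Finset.sum_add_distrib,
        Finset.sum_sub_distrib, Equiv.sum_comp σ fun i => (μ.rowLen i : ℤ),
        Equiv.sum_comp σ fun i : Fin (μ.colLen 0) => ((i : ℕ) : ℤ), sub_add_cancel,
        Fin.sum_univ_eq_sum_range fun i => (μ.rowLen i : ℤ), card_eq_sum_rowLen le_rfl,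
        Nat.cast_sum]
    rw [← h1]
    refine MvPolynomial.IsWeightedHomogeneous.prod _ _ _ fun i _ => ?_
    change (completeInt (e i)).IsWeightedHomogeneous wt _
    rw [completeInt, if_pos (h i)]
    exact homogeneous_complete _
  · push Not at h
    obtain ⟨i, hi⟩ := h
    rw [Finset.prod_eq_zero (mem_univ i) (completeInt_of_neg hi)]
    exact MvPolynomial.isWeightedHomogeneous_zero ℚ wt _

/-! ### Strip removal and the Pieri rule for Schur functions -/

/-- A finite set containing all diagrams contained in `μ`. -/
noncomputable def below (μ : YoungDiagram) : Finset YoungDiagram :=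
  (finite_card_eq_le μ.card).toFinset
where
  finite_card_eq_le (n : ℕ) : {ν : YoungDiagram | ν.card ≤ n}.Finite := by
    have h : {ν : YoungDiagram | ν.card ≤ n} = ⋃ m ∈ Finset.range (n + 1), {ν | ν.card = m} := by
      ext ν
      simp
    rw [h]
    exact Set.Finite.biUnion (Finset.finite_toSet _) fun m _ => finite_card_eq m

theorem mem_below {ν μ : YoungDiagram} : ν ∈ below μ ↔ ν.card ≤ μ.card := by
  simp [below]

open Polynomial

theorem rowLen_eq_zero_of_le {ν μ : YoungDiagram} (h : ν ≤ μ) {i : ℕ} (hi : μ.colLen 0 ≤ i) :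
    ν.rowLen i = 0 :=
  Nat.le_zero.1 ((le_iff_rowLen.1 h i).trans (rowLen_eq_zero hi).le)

theorem colLen_zero_mono {ν μ : YoungDiagram} (h : ν ≤ μ) : ν.colLen 0 ≤ μ.colLen 0 :=
  le_iff_colLen.1 h 0

theorem card_eq_sum_fin {μ : YoungDiagram} {N : ℕ} (hN : μ.colLen 0 ≤ N) :
    (μ.card : ℤ) = ∑ i : Fin N, (μ.rowLen i : ℤ) := by
  rw [Fin.sum_univ_eq_sum_range fun i => (μ.rowLen i : ℤ), card_eq_sum_rowLen hN, Nat.cast_sum]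

theorem exists_rowLen_eq {f : ℕ → ℕ} (hf : ∀ i, f (i + 1) ≤ f i) {M : ℕ} (hM : f M = 0) :
    ∃ μ : YoungDiagram, ∀ i, μ.rowLen i = f i :=
  ⟨ofRows f (antitone_nat_of_succ_le hf) M, rowLen_ofRows hM⟩

theorem exists_rowLen_cons {g : ℕ → ℕ} {m : ℕ} (h0 : g 0 ≤ m) (hg : ∀ i, g (i + 1) ≤ g i) {M : ℕ}
    (hM : g M = 0) : ∃ μ : YoungDiagram, μ.rowLen 0 = m ∧ ∀ i, μ.rowLen (i + 1) = g i := by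
  obtain ⟨μ, hμ⟩ := exists_rowLen_eq (f := fun i => if i = 0 then m else g (i - 1)) (M := M + 1)
    (fun i => by
      rcases i with _ | i
      · exact h0
      · exact hg i) hM
  exact ⟨μ, hμ 0, fun i => hμ (i + 1)⟩

open Classical in
-- With a_i = μ_i - i and b_i = ν_i - i, the windows a_{i+1} < b_i ≤ a_i say μ_{i+1} ≤ ν_i ≤ μ_i,
-- which is the horizontal strip condition.
theorem shift_one_schur (μ : YoungDiagram) : shift 1 (schur ℚ μ) =
    ∑ ν ∈ (below μ).filter (HStrip · μ), X ^ (μ.card - ν.card) * C (schur ℚ ν) := by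
  set N := μ.colLen 0 with hN
  have h0 : μ.rowLen N = 0 := rowLen_eq_zero le_rfl
  have hanti : ∀ i, μ.rowLen (i + 1) ≤ μ.rowLen i := fun i => μ.rowLen_anti _ _ (Nat.le_succ i)
  rw [schur_eq_jt le_rfl, shift_one_jt _ (fun i => (μ.rowLen i : ℤ) - i)
    (fun i => by have := hanti i; push_cast; omega) (by rw [← hN, h0]; simp)]
  symm
  refine Finset.sum_nbij (fun ν => fun i : Fin N => (ν.rowLen i : ℤ) - i) ?_ ?_ ?_ ?_
  · intro ν hν
    have h1 := hStrip_iff_rowLen.1 (mem_filter.1 hν).2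
    rw [Fintype.mem_piFinset]
    intro i
    have := h1 i
    rw [mem_Ioc]
    push_cast
    omega
  · intro ν hν κ hκ h
    have h1 := (mem_filter.1 (mem_coe.1 hν)).2.1
    have h2 := (mem_filter.1 (mem_coe.1 hκ)).2.1
    refine ext_rowLen fun i => ?_
    rcases Nat.lt_or_ge i N with hi | hi
    · have := congrFun h ⟨i, hi⟩
      simpa using this
    · rw [rowLen_eq_zero_of_le h1 hi, rowLen_eq_zero_of_le h2 hi]
  · intro b hb
    rw [mem_coe, Fintype.mem_piFinset] at hb
    simp only [mem_Ioc] at hb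
    obtain ⟨ν, hν⟩ := exists_rowLen_eq
      (f := fun i => if h : i < N then (b ⟨i, h⟩ + i).toNat else 0) (M := N) (fun i => by
        by_cases h : i + 1 < N
        · have h1 := hb ⟨i, by omega⟩
          have h2 := hb ⟨i + 1, h⟩
          rw [dif_pos h, dif_pos (by omega)]
          push_cast at h1 h2 ⊢
          omega
        · rw [dif_neg h]
          exact Nat.zero_le _) (dif_neg (lt_irrefl N))
    have h3 : HStrip ν μ := hStrip_iff_rowLen.2 fun i => by
      rw [hν]
      by_cases h : i < N
      · have h1 := hb ⟨i, h⟩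
        rw [dif_pos h]
        push_cast at h1
        omega
      · rw [dif_neg h, rowLen_eq_zero (i := i + 1) (by omega)]
        omega
    refine ⟨ν, mem_coe.2 (mem_filter.2 ⟨mem_below.2 (card_mono h3.1), h3⟩), ?_⟩
    funext i
    have h1 := hb i
    dsimp only
    rw [hν, dif_pos i.2, Fin.eta]
    push_cast at h1 ⊢
    omega
  · intro ν hν
    have h1 := (mem_filter.1 hν).2
    rw [schur_eq_jt (colLen_zero_mono h1.1)]
    congr 2
    have h2 := card_mono h1.1
    zify [h2]
    rw [card_eq_sum_fin (μ := μ) le_rfl, card_eq_sum_fin (colLen_zero_mono h1.1),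
      ← Finset.sum_sub_distrib]
    refine Finset.sum_congr rfl fun i _ => ?_
    have := le_iff_rowLen.1 h1.1 i
    omega

open Classical in
-- A set of rows shortened by one either leaves a partition, and so gives a vertical strip, or
-- produces a vanishing determinant.
theorem shift_sgn_schur (μ : YoungDiagram) : shift sgn (schur ℚ μ) =
    ∑ ν ∈ (below μ).filter (VStrip · μ), X ^ (μ.card - ν.card) * C (schur ℚ ν) := by
  set N := μ.colLen 0 with hN
  have h0 : μ.rowLen N = 0 := rowLen_eq_zero le_rfl
  have hanti : ∀ i, μ.rowLen (i + 1) ≤ μ.rowLen i := fun i => μ.rowLen_anti _ _ (Nat.le_succ i)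
  rw [schur_eq_jt le_rfl, shift_sgn_jt]
  symm
  refine Finset.sum_of_injOn
    (fun ν => univ.filter fun i : Fin N => ν.rowLen i < μ.rowLen i) ?_ ?_ ?_ ?_
  · intro ν hν κ hκ h
    have h1 := (mem_filter.1 (mem_coe.1 hν)).2
    have h2 := (mem_filter.1 (mem_coe.1 hκ)).2
    refine ext_rowLen fun i => ?_
    rcases Nat.lt_or_ge i N with hi | hi
    · have h3 := Finset.ext_iff.1 h ⟨i, hi⟩
      have h4 := vStrip_iff_rowLen.1 h1 i
      have h5 := vStrip_iff_rowLen.1 h2 i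
      simp only [mem_filter, mem_univ, true_and] at h3
      omega
    · rw [rowLen_eq_zero_of_le h1.1 hi, rowLen_eq_zero_of_le h2.1 hi]
  · exact fun _ _ => mem_coe.2 (mem_univ _)
  · intro s _ hs
    set δ : ℕ → ℕ := fun i => if h : i < N then if (⟨i, h⟩ : Fin N) ∈ s then 1 else 0 else 0 with hδ
    have hδ1 : ∀ i, δ i ≤ 1 := fun i => by
      rw [hδ]
      dsimp only
      split_ifs <;> omega
    have hδN : ∀ i, N ≤ i → δ i = 0 := fun i hi => dif_neg (by omega)
    have hδs : ∀ i : Fin N, δ i = if i ∈ s then 1 else 0 := fun i => dif_pos i.2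
    have hzero : jt N (fun i => (μ.rowLen i : ℤ) - i - if i ∈ s then 1 else 0) = 0 := by
      -- The condition says that μ - δ is weakly decreasing, written without subtraction. If it
      -- fails at i, then μ_i = μ_{i+1}, with row i shortened and row i+1 not; the two matrix rows
      -- coincide, or, at the bottom, the row has only negative indices.
      by_cases hcase : ∀ i, μ.rowLen (i + 1) + δ i ≤ μ.rowLen i + δ (i + 1)
      · exfalso
        have hle : ∀ i, δ i ≤ μ.rowLen i := by
          intro i
          by_cases hi : N ≤ i
          · rw [hδN i hi]
            exact Nat.zero_le _
          · have h1 : N ≤ i + (N - i) := by omega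
            have h2 : ∀ m, δ (i + m) ≤ μ.rowLen (i + m) → δ i ≤ μ.rowLen i := by
              intro m
              induction m with
              | zero => exact id
              | succ m ih =>
                intro h
                have h3 := hcase (i + m)
                rw [← add_assoc] at h
                exact ih (by omega)
            exact h2 (N - i) (by rw [hδN _ h1]; exact Nat.zero_le _)
        obtain ⟨ν, hν⟩ := exists_rowLen_eq (f := fun i => μ.rowLen i - δ i) (M := N) (fun i => by
          have h1 := hcase i
          have h2 := hle i
          have h3 := hle (i + 1)
          omega) (by rw [h0, Nat.zero_sub])
        have h3 : VStrip ν μ := vStrip_iff_rowLen.2 fun i => by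
          have h1 := hδ1 i
          rw [hν]
          omega
        refine hs ⟨ν, mem_coe.2 (mem_filter.2 ⟨mem_below.2 (card_mono h3.1), h3⟩), ?_⟩
        ext i
        have h4 := hle i
        simp only [mem_filter, mem_univ, true_and, hν]
        by_cases hi : i ∈ s
        · have h5 := hδs i
          rw [if_pos hi] at h5
          simp only [hi, iff_true]
          omega
        · have h5 := hδs i
          rw [if_neg hi] at h5
          simp only [hi, iff_false]
          omega
      · push Not at hcase
        obtain ⟨i, hi⟩ := hcase
        have h1 := hanti i
        have h2 := hδ1 i
        have h3 := hδ1 (i + 1)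
        have hiN : i < N := by
          by_contra h
          rw [hδN i (by omega)] at hi
          omega
        have his : (⟨i, hiN⟩ : Fin N) ∈ s := by
          by_contra h
          have := hδs ⟨i, hiN⟩
          rw [if_neg h] at this
          dsimp only at this
          omega
        rcases Nat.lt_or_ge (i + 1) N with h4 | h4
        · have his' : (⟨i + 1, h4⟩ : Fin N) ∉ s := by
            intro h
            have := hδs ⟨i + 1, h4⟩
            rw [if_pos h] at this
            dsimp only at this
            omega
          refine Matrix.det_zero_of_row_eq (i := ⟨i, hiN⟩) (j := ⟨i + 1, h4⟩) (by simp) ?_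
          funext c
          simp only [Matrix.of_apply, if_pos his, if_neg his']
          congr 1
          push_cast
          omega
        · refine Matrix.det_eq_zero_of_row_eq_zero ⟨i, hiN⟩ fun c => ?_
          simp only [Matrix.of_apply, if_pos his]
          have h5 : μ.rowLen (i + 1) = 0 := rowLen_eq_zero h4
          have := c.2
          refine completeInt_of_neg ?_
          omega
    rw [hzero, map_zero, mul_zero]
  · intro ν hν
    have h1 := (mem_filter.1 hν).2
    have h3 := vStrip_iff_rowLen.1 h1
    have hcard : (univ.filter fun i : Fin N => ν.rowLen i < μ.rowLen i).card =
        μ.card - ν.card := by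
      have h2 := card_mono h1.1
      zify [h2]
      rw [card_eq_sum_fin (μ := μ) le_rfl, card_eq_sum_fin (colLen_zero_mono h1.1),
        ← Finset.sum_sub_distrib, Finset.card_filter, Nat.cast_sum]
      refine Finset.sum_congr rfl fun i _ => ?_
      have := h3 i
      split_ifs <;> push_cast <;> omega
    rw [schur_eq_jt (colLen_zero_mono h1.1), hcard]
    congr 3
    funext i
    have := h3 i
    simp only [mem_filter, mem_univ, true_and]
    split_ifs <;> omega

open Classical in
-- The bound k ≥ ν_1 makes the new top row at least as long as the others, so each determinant in
-- `complete_mul_jt` is already that of a partition. Its first part is fixed by the total size,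
-- which is the content of `hfirst`.
theorem complete_mul_schur (ν : YoungDiagram) (k : ℕ) (hk : ν.rowLen 0 ≤ k) :
    complete ℚ k * schur ℚ ν =
      ∑ μ ∈ (partitionsOf (ν.card + k)).filter (HStrip ν ·), schur ℚ μ := by
  set N := ν.colLen 0 with hN
  have h0 : ν.rowLen N = 0 := rowLen_eq_zero le_rfl
  have hanti : ∀ i, ν.rowLen (i + 1) ≤ ν.rowLen i := fun i => ν.rowLen_anti _ _ (Nat.le_succ i)
  have hcol : ∀ {μ}, HStrip ν μ → μ.colLen 0 ≤ N + 1 := fun {μ} h =>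
    colLen_zero_le (Nat.le_zero.1 ((hStrip_iff_rowLen.1 h N).2.trans h0.le))
  have hfirst : ∀ {μ}, HStrip ν μ → μ.card = ν.card + k →
      (μ.rowLen 0 : ℤ) = k + ∑ i : Fin N, ((ν.rowLen i : ℤ) - μ.rowLen (i + 1)) := by
    intro μ h hc
    have h1 := card_eq_sum_fin (hcol h)
    rw [Fin.sum_univ_succ, hc, Nat.cast_add, card_eq_sum_fin (μ := ν) le_rfl] at h1
    rw [Finset.sum_sub_distrib]
    simp only [Fin.val_zero, Fin.val_succ] at h1
    linarith
  rw [schur_eq_jt le_rfl, ← completeInt_natCast, complete_mul_jt _ _ (fun i => (ν.rowLen i : ℤ) - i)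
    (fun i => by have := hanti i; push_cast; omega) (by rw [← hN, h0]; simp)]
  symm
  refine Finset.sum_nbij (fun μ => fun i : Fin N => (μ.rowLen (i + 1) : ℤ) - i) ?_ ?_ ?_ ?_
  · intro μ hμ
    have h1 := hStrip_iff_rowLen.1 (mem_filter.1 hμ).2
    rw [Fintype.mem_piFinset]
    intro i
    have h2 := h1 i
    have h3 := h1 (i + 1)
    rw [mem_Ioc]
    push_cast
    omega
  · intro μ hμ κ hκ h
    obtain ⟨h1, h2⟩ := mem_filter.1 (mem_coe.1 hμ)
    obtain ⟨h3, h4⟩ := mem_filter.1 (mem_coe.1 hκ)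
    rw [mem_partitionsOf] at h1 h3
    have h5 : ∀ i : Fin N, μ.rowLen (i + 1) = κ.rowLen (i + 1) := fun i => by
      have := congrFun h i
      simpa using this
    refine ext_rowLen fun i => ?_
    rcases i with _ | i
    · have h6 := hfirst h2 h1
      have h7 := hfirst h4 h3
      simp only [h5] at h6
      omega
    · rcases Nat.lt_or_ge i N with hi | hi
      · exact h5 ⟨i, hi⟩
      · rw [rowLen_eq_zero ((hcol h2).trans (by omega)), rowLen_eq_zero ((hcol h4).trans (by omega))]
  · intro b hb
    rw [mem_coe, Fintype.mem_piFinset] at hb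
    simp only [mem_Ioc] at hb
    set S : ℕ := ∑ i : Fin N, ((ν.rowLen i : ℤ) - i - b i).toNat with hS
    obtain ⟨μ, hμ0, hμ⟩ := exists_rowLen_cons
      (g := fun i => if h : i < N then (b ⟨i, h⟩ + i).toNat else 0) (M := N) (m := k + S) (by
        split_ifs with h
        · have h1 := hb ⟨0, h⟩
          push_cast at h1 ⊢
          omega
        · exact Nat.zero_le _) (fun i => by
        by_cases h : i + 1 < N
        · have h1 := hb ⟨i, by omega⟩
          have h2 := hb ⟨i + 1, h⟩
          rw [dif_pos h, dif_pos (by omega)]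
          push_cast at h1 h2 ⊢
          omega
        · rw [dif_neg h]
          exact Nat.zero_le _) (dif_neg (lt_irrefl N))
    have hμs : ∀ i : Fin N, (μ.rowLen (i + 1) : ℤ) = b i + i := fun i => by
      have h1 := hb i
      rw [hμ, dif_pos i.2, Fin.eta]
      push_cast at h1 ⊢
      omega
    have h3 : HStrip ν μ := hStrip_iff_rowLen.2 fun i => by
      refine ⟨?_, ?_⟩
      · rcases i with _ | i
        · omega
        · rcases Nat.lt_or_ge i N with hi | hi
          · have h1 := hb ⟨i, hi⟩
            have h2 := hμs ⟨i, hi⟩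
            push_cast at h1 h2
            omega
          · rw [rowLen_eq_zero (by omega : ν.colLen 0 ≤ i + 1)]
            exact Nat.zero_le _
      · rcases Nat.lt_or_ge i N with hi | hi
        · have h1 := hb ⟨i, hi⟩
          have h2 := hμs ⟨i, hi⟩
          push_cast at h1 h2
          omega
        · rw [hμ, dif_neg (by omega)]
          exact Nat.zero_le _
    have hc : μ.card = ν.card + k := by
      zify
      rw [card_eq_sum_fin (hcol h3), Fin.sum_univ_succ, card_eq_sum_fin (μ := ν) le_rfl]
      simp only [Fin.val_zero, Fin.val_succ, hμs]
      rw [hμ0, hS]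
      rw [Nat.cast_add, Nat.cast_sum]
      have h4 : ∀ i : Fin N, (((ν.rowLen i : ℤ) - i - b i).toNat : ℤ) =
          (ν.rowLen i : ℤ) - (b i + i) := fun i => by
        have h1 := hb i
        push_cast at h1
        omega
      rw [Finset.sum_congr rfl fun i _ => h4 i, Finset.sum_sub_distrib]
      ring
    refine ⟨μ, mem_coe.2 (mem_filter.2 ⟨mem_partitionsOf.2 hc, h3⟩), ?_⟩
    funext i
    dsimp only
    rw [hμs]
    ring
  · intro μ hμ
    obtain ⟨h1, h2⟩ := mem_filter.1 hμ
    rw [mem_partitionsOf] at h1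
    rw [schur_eq_jt (hcol h2)]
    congr 1
    funext i
    refine Fin.cases ?_ (fun i => ?_) i
    · rw [Fin.cons_zero, Fin.val_zero, hfirst h2 h1, Nat.cast_zero, sub_zero, Nat.cast_sum]
      congr 1
      refine Finset.sum_congr rfl fun i _ => ?_
      have := hStrip_iff_rowLen.1 h2 i
      dsimp only
      omega
    · rw [Fin.cons_succ, Fin.val_succ]
      push_cast
      ring

/-! ### Adjoint operators on Schur functions, and the action of ω -/

open Polynomial in
theorem coeff_X_pow_mul_C' {R : Type*} [CommRing R] (a : R) (k m : ℕ) :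
    ((X : R[X]) ^ m * C a).coeff k = if m = k then a else 0 := by
  rw [mul_comm, coeff_C_mul_X_pow]
  exact if_congr eq_comm rfl rfl

open Classical in
theorem perp_one_schur {μ : YoungDiagram} {n k : ℕ} (h : n + k = μ.card) :
    perp 1 k (schur ℚ μ) = ∑ ν ∈ (partitionsOf n).filter (HStrip · μ), schur ℚ ν := by
  rw [perp_apply, shift_one_schur, Polynomial.finsetSum_coeff]
  simp only [coeff_X_pow_mul_C']
  rw [← Finset.sum_filter, Finset.filter_filter]
  refine Finset.sum_congr (Finset.ext fun ν => ?_) fun _ _ => rfl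
  simp only [mem_filter, mem_below, mem_partitionsOf]
  constructor
  · rintro ⟨h1, h2, h3⟩
    exact ⟨by omega, h2⟩
  · rintro ⟨h1, h2⟩
    exact ⟨by omega, h2, by omega⟩

open Classical in
theorem perp_sgn_schur {μ : YoungDiagram} {n k : ℕ} (h : n + k = μ.card) :
    perp sgn k (schur ℚ μ) = ∑ ν ∈ (partitionsOf n).filter (VStrip · μ), schur ℚ ν := by
  rw [perp_apply, shift_sgn_schur, Polynomial.finsetSum_coeff]
  simp only [coeff_X_pow_mul_C']
  rw [← Finset.sum_filter, Finset.filter_filter]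
  refine Finset.sum_congr (Finset.ext fun ν => ?_) fun _ _ => rfl
  simp only [mem_filter, mem_below, mem_partitionsOf]
  constructor
  · rintro ⟨h1, h2, h3⟩
    exact ⟨by omega, h2⟩
  · rintro ⟨h1, h2⟩
    exact ⟨by omega, h2, by omega⟩

theorem perp_one_schur_eq_zero {μ : YoungDiagram} {k : ℕ} (h : μ.card < k) :
    perp 1 k (schur ℚ μ) = 0 := by
  classical
  rw [perp_apply, shift_one_schur, Polynomial.finsetSum_coeff]
  refine Finset.sum_eq_zero fun ν _ => ?_
  rw [coeff_X_pow_mul_C', if_neg (by omega)]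

theorem perp_sgn_schur_eq_zero {μ : YoungDiagram} {k : ℕ} (h : μ.card < k) :
    perp sgn k (schur ℚ μ) = 0 := by
  classical
  rw [perp_apply, shift_sgn_schur, Polynomial.finsetSum_coeff]
  refine Finset.sum_eq_zero fun ν _ => ?_
  rw [coeff_X_pow_mul_C', if_neg (by omega)]

theorem schur_bot : schur ℚ ⊥ = 1 := by
  have h : (⊥ : YoungDiagram).colLen 0 ≤ 0 := by
    rw [YoungDiagram.colLen_eq_card]
    simp [YoungDiagram.col]
  rw [schur_eq_jt h, jt, Matrix.det_fin_zero]

theorem coeff_zero_schur {μ : YoungDiagram} (hμ : μ.card ≠ 0) : (schur ℚ μ).coeff 0 = 0 := by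
  by_contra h
  exact hμ (by simpa using (homogeneous_schur μ h).symm)

theorem coeff_zero_omega (f : Sym ℚ) : (omega f).coeff 0 = f.coeff 0 := by
  have h : (MvPolynomial.constantCoeff (R := ℚ) (σ := ℕ+)).comp omega.toRingHom =
      MvPolynomial.constantCoeff := by
    refine MvPolynomial.ringHom_ext (fun a => ?_) fun r => ?_
    · simp
    · simp [omega_X]
  exact congrArg (fun φ : Sym ℚ →+* ℚ => φ f) h

/-- ω exchanges the adjoints of h_k and e_k, and transposition exchanges the two kinds of strips. By
induction on size the two sides agree after every positive-order adjoint of e_k, so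
`eq_zero_of_perp` applies to their difference. -/
theorem omega_schur (μ : YoungDiagram) : omega (schur ℚ μ) = schur ℚ μ.transpose := by
  classical
  induction hn : μ.card using Nat.strong_induction_on generalizing μ with
  | _ n ih =>
    subst hn
    by_cases h0 : μ.card = 0
    · have h1 : μ.transpose = ⊥ := card_eq_zero_iff.1 ((card_transpose μ).trans h0)
      rw [h1, card_eq_zero_iff.1 h0, schur_bot, map_one]
    · rw [← sub_eq_zero]
      refine eq_zero_of_perp sgn_ne_zero ?_ fun k => ?_
      · rw [MvPolynomial.coeff_sub, coeff_zero_omega, coeff_zero_schur h0,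
          coeff_zero_schur (by rwa [card_transpose]), sub_zero]
      · rw [map_sub, perp_omega, sub_eq_zero]
        rcases Nat.lt_or_ge μ.card (k + 1) with hk | hk
        · rw [perp_one_schur_eq_zero hk, perp_sgn_schur_eq_zero (by rwa [card_transpose]), map_zero]
        · have h1 : μ.card - (k + 1) + (k + 1) = μ.card := by omega
          rw [perp_one_schur h1, perp_sgn_schur (h1.trans (card_transpose μ).symm), map_sum]
          refine Finset.sum_nbij' YoungDiagram.transpose YoungDiagram.transpose ?_ ?_ ?_ ?_ ?_
          · intro ν hν
            rw [mem_filter, mem_partitionsOf] at hν ⊢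
            rw [card_transpose, ← hStrip_transpose, YoungDiagram.transpose_transpose,
              YoungDiagram.transpose_transpose]
            exact hν
          · intro ν hν
            rw [mem_filter, mem_partitionsOf, ← hStrip_transpose,
              YoungDiagram.transpose_transpose] at hν
            rwa [mem_filter, mem_partitionsOf, card_transpose]
          · exact fun ν _ => YoungDiagram.transpose_transpose ν
          · exact fun ν _ => YoungDiagram.transpose_transpose ν
          · intro ν hν
            rw [mem_filter, mem_partitionsOf] at hν
            exact ih ν.card (by omega) ν rfl

/-! ### Orthonormality and completeness of the Schur functions -/

open Classical in
theorem hallForm_complete_mul_schur {μ : YoungDiagram} {n k : ℕ} (h : n + k = μ.card) (f : Sym ℚ) :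
    hallForm (complete ℚ k * f) (schur ℚ μ) =
      ∑ ν ∈ (partitionsOf n).filter (HStrip · μ), hallForm f (schur ℚ ν) := by
  rw [hallForm_complete_mul, perp_one_schur h, map_sum]

open Classical in
theorem hallForm_omega_complete_mul_schur {μ : YoungDiagram} {n k : ℕ} (h : n + k = μ.card)
    (f : Sym ℚ) : hallForm (omega (complete ℚ k) * f) (schur ℚ μ) =
      ∑ ν ∈ (partitionsOf n).filter (VStrip · μ), hallForm f (schur ℚ ν) := by
  rw [hallForm_omega_complete_mul, perp_sgn_schur h, map_sum]

open Classical in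
/-- A linear functional is determined on Schur functions by its values on the products
`h_k s_ν` with `k ≥ ν_1`. -/
theorem apply_schur_eq (φ : Sym ℚ →ₗ[ℚ] ℚ) (c : YoungDiagram → ℚ) {N : ℕ} (hN : N ≠ 0)
    (H : ∀ (ν : YoungDiagram) (k : ℕ), 0 < k → ν.card + k = N → φ (complete ℚ k * schur ℚ ν) =
      ∑ μ ∈ (partitionsOf N).filter (HStrip ν ·), c μ) {μ : YoungDiagram} (hμ : μ.card = N) :
    φ (schur ℚ μ) = c μ := by
  induction hm : N - μ.rowLen 0 using Nat.strong_induction_on generalizing μ with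
  | _ m ih =>
    -- With ν equal to μ without its first row, s_μ occurs in h_{μ_1} s_ν and every other term has a
    -- longer first row. The induction therefore runs on N - μ_1.
    obtain ⟨ν, hν⟩ := exists_rowLen_eq (f := fun i => μ.rowLen (i + 1)) (M := μ.colLen 0)
      (fun i => μ.rowLen_anti _ _ (by omega)) (rowLen_eq_zero (by omega))
    have h0 : 0 < μ.rowLen 0 := by
      rw [Nat.pos_iff_ne_zero]
      intro h
      rw [card_eq_sum_colLen h.le, Finset.sum_range_zero] at hμ
      exact hN hμ.symm
    have hs : HStrip ν μ := hStrip_iff_rowLen.2 fun i => by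
      rw [hν]
      exact ⟨μ.rowLen_anti _ _ (by omega), le_rfl⟩
    have hcard : ν.card + μ.rowLen 0 = N := by
      rw [← hμ, card_eq_sum_rowLen (μ := μ) (M := μ.colLen 0 + 1) (by omega),
        card_eq_sum_rowLen (colLen_zero_mono hs.1), Finset.sum_range_succ']
      simp only [hν]
    have h1 := H ν (μ.rowLen 0) h0 hcard
    rw [complete_mul_schur ν _ ((hν 0).trans_le (μ.rowLen_anti _ _ (by omega))), map_sum,
      hcard] at h1
    have hmem : μ ∈ (partitionsOf N).filter (HStrip ν ·) :=
      mem_filter.2 ⟨mem_partitionsOf.2 hμ, hs⟩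
    rw [← Finset.add_sum_erase _ _ hmem, ← Finset.add_sum_erase _ c hmem,
      Finset.sum_congr rfl (g := c) fun κ hκ => ?_] at h1
    · exact add_right_cancel h1
    · rw [mem_erase, mem_filter, mem_partitionsOf] at hκ
      obtain ⟨hne, hc, hst⟩ := hκ
      have h2 : μ.rowLen 0 < κ.rowLen 0 := by
        by_contra! hle
        refine hne (eq_of_le_of_card_le (le_iff_rowLen.2 fun i => ?_) (by omega))
        rcases i with _ | i
        · exact hle
        · rw [← hν]
          exact (hStrip_iff_rowLen.1 hst i).2
      have h3 := rowLen_le_card κ 0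
      exact ih _ (by omega) hc rfl

theorem hallForm_one_one : hallForm 1 1 = 1 := by
  have h := hallForm_monomial 0 1 (1 : Sym ℚ)
  rw [MvPolynomial.coeff_zero_one] at h
  simpa [zee] using h

open Classical in
-- Pairing h_k s_κ with s_ν through the adjoint gives, by induction, 1 exactly when ν/κ is a
-- horizontal strip; the Pieri rule predicts the same value.
theorem hallForm_schur_of_card_eq {μ ν : YoungDiagram} (h : μ.card = ν.card) :
    hallForm (schur ℚ μ) (schur ℚ ν) = if μ = ν then 1 else 0 := by
  induction hn : ν.card using Nat.strong_induction_on generalizing μ ν with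
  | _ n ih =>
    subst hn
    by_cases h0 : ν.card = 0
    · rw [card_eq_zero_iff.1 h0, card_eq_zero_iff.1 (h.trans h0), if_pos rfl, schur_bot,
        hallForm_one_one]
    · refine apply_schur_eq (hallForm.flip (schur ℚ ν)) (fun κ => if κ = ν then 1 else 0) h0
        (fun κ k hk hc => ?_) h
      rw [LinearMap.flip_apply, hallForm_complete_mul_schur hc,
        Finset.sum_congr rfl (g := fun τ => if κ = τ then (1 : ℚ) else 0) fun τ hτ => ?_]
      · by_cases hs : HStrip κ ν
        · rw [Finset.sum_eq_single_of_mem κ (mem_filter.2 ⟨mem_partitionsOf.2 rfl, hs⟩)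
            fun τ _ hne => if_neg hne.symm, if_pos rfl, Finset.sum_eq_single_of_mem ν
            (mem_filter.2 ⟨mem_partitionsOf.2 rfl, hs⟩) fun τ _ hne => if_neg hne, if_pos rfl]
        · rw [Finset.sum_eq_zero, Finset.sum_eq_zero]
          · intro τ hτ
            refine if_neg fun h => ?_
            subst h
            exact hs (mem_filter.1 hτ).2
          · intro τ hτ
            refine if_neg fun h => ?_
            subst h
            exact hs (mem_filter.1 hτ).2
      · rw [mem_filter, mem_partitionsOf] at hτ
        exact ih τ.card (by omega) hτ.1.symm rfl

/-- The diagram with `d r` rows of length `r`. -/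
noncomputable def ofMult (d : ℕ+ →₀ ℕ) : YoungDiagram :=
  ofCols (fun j => ∑ r ∈ d.support, if j < (r : ℕ) then d r else 0)
    (fun i j hij => Finset.sum_le_sum fun r _ => by split_ifs <;> omega)
    (d.support.sup fun r => (r : ℕ))

theorem colLen_ofMult (d : ℕ+ →₀ ℕ) (j : ℕ) :
    (ofMult d).colLen j = ∑ r ∈ d.support, if j < (r : ℕ) then d r else 0 := by
  refine colLen_ofCols (Finset.sum_eq_zero fun r hr => if_neg (not_lt.2 ?_)) j
  exact Finset.le_sup (f := fun r : ℕ+ => (r : ℕ)) hr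

/-- The multiplicity of r is the difference of the column lengths at r - 1 and r. -/
theorem ofMult_injective : Function.Injective ofMult := by
  have h : ∀ (d : ℕ+ →₀ ℕ) (m : ℕ), (ofMult d).colLen m =
      (ofMult d).colLen (m + 1) + d m.succPNat := by
    intro d m
    rw [colLen_ofMult, colLen_ofMult]
    have h1 : d m.succPNat = ∑ r ∈ d.support, if r = m.succPNat then d r else 0 := by
      rw [Finset.sum_ite_eq']
      split_ifs with h
      · rfl
      · exact Finsupp.notMem_support_iff.1 h
    rw [h1, ← Finset.sum_add_distrib]
    refine Finset.sum_congr rfl fun r _ => ?_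
    have h2 : r = m.succPNat ↔ (r : ℕ) = m + 1 := by
      rw [← PNat.coe_inj, Nat.succPNat_coe]
    rw [if_congr h2 rfl rfl]
    split_ifs <;> omega
  intro d d' hd
  ext r
  rw [← PNat.succPNat_natPred r]
  have h1 := h d r.natPred
  have h2 := h d' r.natPred
  rw [hd] at h1
  omega

theorem card_ofMult (d : ℕ+ →₀ ℕ) : (ofMult d).card = Finsupp.weight wt d := by
  set M := d.support.sup fun r => (r : ℕ) with hM
  have hle : ∀ r ∈ d.support, (r : ℕ) ≤ M := fun r hr =>
    Finset.le_sup (f := fun r : ℕ+ => (r : ℕ)) hr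
  rw [card_eq_sum_colLen (M := M) (rowLen_zero_le ?_)]
  · simp only [colLen_ofMult]
    rw [Finset.sum_comm, Finsupp.weight_apply, Finsupp.sum]
    refine Finset.sum_congr rfl fun r hr => ?_
    have h1 : (range M).filter (· < (r : ℕ)) = range r := by
      ext j
      have := hle r hr
      simp only [mem_filter, mem_range]
      omega
    rw [← Finset.sum_filter, h1, Finset.sum_const, card_range, smul_eq_mul, smul_eq_mul, mul_comm,
      wt]
  · rw [colLen_ofMult]
    exact Finset.sum_eq_zero fun r hr => if_neg (not_lt.2 (hle r hr))

/-- Orthonormality reads A B = 1, where A is the matrix of Schur functions in the power sums and B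
is its transpose weighted by z. So A is surjective and there are at most as many partitions as
power-sum monomials; `ofMult` gives the opposite inequality. Hence B A = 1, which is the expansion
formula. -/
theorem eq_sum_hallForm_smul_schur {f : Sym ℚ} {n : ℕ} (hf : f.IsWeightedHomogeneous wt n) :
    f = ∑ μ ∈ partitionsOf n, hallForm (schur ℚ μ) f • schur ℚ μ := by
  classical
  let D := {d : ℕ+ →₀ ℕ // Finsupp.weight wt d = n}
  let Y := {μ : YoungDiagram // μ ∈ partitionsOf n}
  let ι : D → Y := fun d => ⟨ofMult d.1, mem_partitionsOf.2 ((card_ofMult _).trans d.2)⟩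
  have hι : Function.Injective ι := fun d d' h =>
    Subtype.ext (ofMult_injective (congrArg Subtype.val h))
  have : Finite D := Finite.of_injective ι hι
  have : Fintype D := Fintype.ofFinite D
  have hsum : ∀ g f : Sym ℚ, f.IsWeightedHomogeneous wt n →
      hallForm f g = ∑ d : D, (zee d.1 : ℚ) * f.coeff d.1 * g.coeff d.1 := by
    intro g f hf
    rw [hallForm_apply, hall_eq_sum (S := univ.map
      (Function.Embedding.subtype fun d => Finsupp.weight wt d = n)), Finset.sum_map]
    · rfl
    · intro d hd
      rw [mem_map]
      exact ⟨⟨d, hf (MvPolynomial.mem_support_iff.1 hd)⟩, mem_univ _, rfl⟩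
  let A : Matrix Y D ℚ := Matrix.of fun μ d => (schur ℚ μ.1).coeff d.1
  let B : Matrix D Y ℚ := Matrix.of fun d μ => (zee d.1 : ℚ) * (schur ℚ μ.1).coeff d.1
  have hY : ∀ μ : Y, μ.1.card = n := fun μ => mem_partitionsOf.1 μ.2
  have hhom : ∀ μ : Y, (schur ℚ μ.1).IsWeightedHomogeneous wt n := fun μ => by
    have := homogeneous_schur μ.1
    rwa [hY μ] at this
  have hAB : A * B = 1 := by
    ext μ ν
    have h1 := hallForm_schur_of_card_eq ((hY μ).trans (hY ν).symm)
    rw [hsum _ _ (hhom μ)] at h1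
    rw [Matrix.mul_apply, Matrix.one_apply, if_congr Subtype.ext_iff rfl rfl, ← h1]
    refine Finset.sum_congr rfl fun d _ => ?_
    simp only [A, B, Matrix.of_apply]
    ring
  have hcard : Fintype.card Y = Fintype.card D := by
    refine le_antisymm (card_le_of_surjective ℚ A.mulVecLin fun y => ⟨B.mulVec y, ?_⟩)
      (Fintype.card_le_of_injective ι hι)
    rw [Matrix.mulVecLin_apply, Matrix.mulVec_mulVec, hAB, Matrix.one_mulVec]
  have hBA : B * A = 1 := (Matrix.mul_eq_one_comm_of_equiv (Fintype.equivOfCardEq hcard)).1 hAB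
  ext d
  rw [← Finset.sum_coe_sort, MvPolynomial.coeff_sum]
  simp only [MvPolynomial.coeff_smul, smul_eq_mul]
  by_cases hd : Finsupp.weight wt d = n
  · have h1 : ∀ e : D, ∑ μ : Y, (zee e.1 : ℚ) * (schur ℚ μ.1).coeff e.1 * (schur ℚ μ.1).coeff d =
        if e = ⟨d, hd⟩ then 1 else 0 := by
      intro e
      have := congrFun (congrFun hBA e) ⟨d, hd⟩
      rwa [Matrix.mul_apply, Matrix.one_apply] at this
    have h2 : ∀ μ : Y, hallForm (schur ℚ μ.1) f * (schur ℚ μ.1).coeff d = ∑ e : D, f.coeff e.1 *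
        ((zee e.1 : ℚ) * (schur ℚ μ.1).coeff e.1 * (schur ℚ μ.1).coeff d) := by
      intro μ
      rw [hsum _ _ (hhom μ), Finset.sum_mul]
      exact Finset.sum_congr rfl fun e _ => by ring
    refine Eq.trans ?_ (Finset.sum_congr rfl fun μ _ => (h2 μ).symm)
    rw [Finset.sum_comm]
    rw [Finset.sum_congr rfl fun e _ => (Finset.mul_sum _ _ _).symm.trans
      (congrArg (f.coeff e.1 * ·) (h1 e)), Finset.sum_eq_single (⟨d, hd⟩ : D)]
    · rw [if_pos rfl, mul_one]
    · intro e _ he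
      rw [if_neg he, mul_zero]
    · exact fun h => absurd (mem_univ _) h
  · have h1 : f.coeff d = 0 := by
      by_contra h
      exact hd (hf h)
    rw [h1]
    refine (Finset.sum_eq_zero fun μ _ => ?_).symm
    have h2 : (schur ℚ μ.1).coeff d = 0 := by
      by_contra h
      exact hd (hhom μ h)
    rw [h2, mul_zero]

/-! ### Explicit formulas for the hook, e_2 and e_2[e_2] -/

theorem rowLen_ofRowLens' (w : List ℕ) (hw : w.SortedGE) (i : ℕ) :
    (YoungDiagram.ofRowLens w hw).rowLen i = w.getD i 0 := by
  refine eq_of_forall_lt_iff fun c => ?_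
  rw [← YoungDiagram.mem_iff_lt_rowLen, YoungDiagram.mem_ofRowLens]
  by_cases h : i < w.length
  · simp [List.getD, h]
  · simp [List.getD, h]

theorem completeInt_zero : completeInt 0 = 1 :=
  (completeInt_natCast 0).trans (complete_zero ℚ)

theorem schur_col2_eq_sub : schur ℚ col2 = complete ℚ 1 * complete ℚ 1 - complete ℚ 2 := by
  rw [schur_eq_jt (N := 2) (colLen_zero_le (by rw [col2, rowLen_ofRowLens']; rfl)), jt,
    Matrix.det_fin_two]
  simp only [Matrix.of_apply, col2, rowLen_ofRowLens', ← completeInt_natCast]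
  norm_num [completeInt_zero]

theorem schur_of_rowLens {μ : YoungDiagram} {a : ℕ} (h0 : μ.rowLen 0 = a) (h1 : μ.rowLen 1 = 1)
    (h2 : μ.rowLen 2 = 1) (h3 : μ.rowLen 3 = 0) :
    schur ℚ μ = complete ℚ a * schur ℚ col2 - complete ℚ (a + 1) * complete ℚ 1 +
      complete ℚ (a + 2) := by
  rw [schur_eq_jt (N := 3) (colLen_zero_le h3), jt, Matrix.det_fin_three, schur_col2_eq_sub]
  simp only [Matrix.of_apply, ← completeInt_natCast]
  norm_num [h0, h1, h2, completeInt_zero, completeInt_of_neg]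
  ring

theorem schur_hook (h : ℕ) (hh : 3 ≤ h) : schur ℚ (hook h hh) =
    complete ℚ (h - 2) * schur ℚ col2 - complete ℚ (h - 1) * complete ℚ 1 + complete ℚ h := by
  rw [schur_of_rowLens (a := h - 2), show h - 2 + 1 = h - 1 by omega,
    show h - 2 + 2 = h by omega]
  all_goals
    rw [hook, rowLen_ofRowLens']
    rfl

theorem schur_shape211 : schur ℚ shape211 =
    complete ℚ 2 * schur ℚ col2 - complete ℚ 3 * complete ℚ 1 + complete ℚ 4 := by
  rw [schur_of_rowLens (a := 2)]
  all_goals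
    rw [shape211, rowLen_ofRowLens']
    rfl

theorem complete_one_rat : complete ℚ 1 = MvPolynomial.X 1 := complete_one ℚ

theorem two_mul_complete_two : 2 * complete ℚ 2 =
    MvPolynomial.X 1 * MvPolynomial.X 1 + MvPolynomial.X 2 := by
  have h := (hasLogDeriv_mk_iff.1 (hasLogDeriv_complete ℚ)).2 1
  simp only [Finset.sum_range_succ, Finset.sum_range_zero, powerSum, complete_zero, zero_add,
    Nat.sub_zero, Nat.sub_self, complete_one_rat, mul_one] at h
  calc 2 * complete ℚ 2 = (((1 : ℕ) : Sym ℚ) + 1) * complete ℚ 2 := by push_cast; ring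
    _ = _ := h

theorem three_mul_complete_three : 3 * complete ℚ 3 = MvPolynomial.X 1 * complete ℚ 2 +
    MvPolynomial.X 2 * MvPolynomial.X 1 + MvPolynomial.X 3 := by
  have h := (hasLogDeriv_mk_iff.1 (hasLogDeriv_complete ℚ)).2 2
  simp only [Finset.sum_range_succ, Finset.sum_range_zero, powerSum, complete_zero, zero_add,
    Nat.sub_zero, Nat.sub_self, show 2 - 1 = 1 from rfl, complete_one_rat, mul_one] at h
  calc 3 * complete ℚ 3 = (((2 : ℕ) : Sym ℚ) + 1) * complete ℚ 3 := by push_cast; ring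
    _ = _ := h

theorem four_mul_complete_four : 4 * complete ℚ 4 = MvPolynomial.X 1 * complete ℚ 3 +
    MvPolynomial.X 2 * complete ℚ 2 + MvPolynomial.X 3 * MvPolynomial.X 1 +
    MvPolynomial.X 4 := by
  have h := (hasLogDeriv_mk_iff.1 (hasLogDeriv_complete ℚ)).2 3
  simp only [Finset.sum_range_succ, Finset.sum_range_zero, powerSum, complete_zero, zero_add,
    Nat.sub_zero, Nat.sub_self, show 3 - 1 = 2 from rfl, show 3 - 2 = 1 from rfl,
    complete_one_rat, mul_one] at h
  calc 4 * complete ℚ 4 = (((3 : ℕ) : Sym ℚ) + 1) * complete ℚ 4 := by push_cast; ring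
    _ = _ := h

theorem two_mul_C_half : (2 : Sym ℚ) * MvPolynomial.C (1 / 2) = 1 := by
  rw [← map_ofNat (MvPolynomial.C (σ := ℕ+) (R := ℚ)) 2, ← MvPolynomial.C_mul]
  norm_num

theorem schur_col2 : schur ℚ col2 =
    MvPolynomial.C (1 / 2) * (MvPolynomial.X 1 ^ 2 - MvPolynomial.X 2) := by
  have h1 : 2 * schur ℚ col2 = MvPolynomial.X 1 ^ 2 - MvPolynomial.X 2 := by
    rw [schur_col2_eq_sub, complete_one_rat]
    linear_combination -two_mul_complete_two
  rw [← h1, ← mul_assoc, mul_comm (MvPolynomial.C _), two_mul_C_half, one_mul]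

theorem schur_col2_eq_omega : schur ℚ col2 = omega (complete ℚ 2) := by
  have h1 := congrArg omega two_mul_complete_two
  have h2 : sgn 1 = 1 := by norm_num [sgn]
  have h3 : sgn 2 = -1 := by norm_num [sgn]
  rw [map_mul, map_ofNat, map_add, map_mul, omega_X, omega_X, h2, h3, MvPolynomial.C_1, one_mul,
    MvPolynomial.C_neg, MvPolynomial.C_1] at h1
  rw [schur_col2]
  linear_combination -MvPolynomial.C (1 / 2) * h1 + omega (complete ℚ 2) * two_mul_C_half

theorem powerSumPlethysm_schur_col2 (r : ℕ+) : powerSumPlethysm ℚ r (schur ℚ col2) =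
    MvPolynomial.C (1 / 2) * (MvPolynomial.X r ^ 2 - MvPolynomial.X (r * 2)) := by
  rw [powerSumPlethysm, schur_col2, map_mul, map_sub, map_pow, MvPolynomial.aeval_X,
    MvPolynomial.aeval_X, mul_one, MvPolynomial.aeval_C]
  rfl

/-- The plethysm `h_n[e_2]`. -/
noncomputable def completePlethysm (n : ℕ) : Sym ℚ := plethysm (complete ℚ n) (schur ℚ col2)

/-- Both sides are polynomials in p_1, h_2, h_3, h_4 once the higher power sums are eliminated by
Newton's identities; the rest is a ring identity. -/
theorem plethysm_schur_col2_col2 :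
    plethysm (schur ℚ col2) (schur ℚ col2) = schur ℚ shape211 := by
  have h1 : plethysm (schur ℚ col2) (schur ℚ col2) = MvPolynomial.C (1 / 2) *
      (powerSumPlethysm ℚ 1 (schur ℚ col2) ^ 2 - powerSumPlethysm ℚ 2 (schur ℚ col2)) := by
    conv_lhs => rw [plethysm, schur_col2]
    rw [map_mul, map_sub, map_pow, MvPolynomial.aeval_X, MvPolynomial.aeval_X,
      MvPolynomial.aeval_C, ← schur_col2]
    rfl
  rw [h1, powerSumPlethysm_schur_col2, powerSumPlethysm_schur_col2, one_mul,
    show (2 : ℕ+) * 2 = 4 from rfl, ← schur_col2, schur_shape211, schur_col2_eq_sub,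
    complete_one_rat]
  set c : Sym ℚ := MvPolynomial.C (1 / 2)
  have hc := two_mul_C_half
  have e2 : (MvPolynomial.X 2 : Sym ℚ) = 2 * complete ℚ 2 - MvPolynomial.X 1 * MvPolynomial.X 1 := by
    linear_combination -two_mul_complete_two
  have e3 : (MvPolynomial.X 3 : Sym ℚ) = 3 * complete ℚ 3 - MvPolynomial.X 1 * complete ℚ 2 -
      MvPolynomial.X 2 * MvPolynomial.X 1 := by
    linear_combination -three_mul_complete_three
  have e4 : (MvPolynomial.X 4 : Sym ℚ) = 4 * complete ℚ 4 - MvPolynomial.X 1 * complete ℚ 3 -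
      MvPolynomial.X 2 * complete ℚ 2 - MvPolynomial.X 3 * MvPolynomial.X 1 := by
    linear_combination -four_mul_complete_four
  rw [e4, e3, e2]
  -- Here c = 1/2 is an opaque constant. Multiplying the identity by 4 clears the denominators,
  -- since only c and c² occur outside e_2 itself.
  have hc4 : 4 * c * c = 1 := by linear_combination (2 * c + 1) * hc
  have h4 : (4 : Sym ℚ) ≠ 0 := left_ne_zero_of_mul_eq_one ((mul_assoc _ _ _).symm.trans hc4)
  refine mul_left_cancel₀ h4 ?_
  generalize complete ℚ 2 = x2, complete ℚ 3 = x3, complete ℚ 4 = x4,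
    (MvPolynomial.X 1 : Sym ℚ) = x1
  linear_combination (exp := 1) 2 * (x1 * x1 - x2) ^ 2 * hc -
    ((2 * x2 - x1 * x1) ^ 2 - (4 * x4 - x1 * x3 - (2 * x2 - x1 * x1) * x2 -
      (3 * x3 - x1 * x2 - (2 * x2 - x1 * x1) * x1) * x1)) * hc4

/-! ### Littlewood's expansion of h_n[e_2] -/

open Polynomial in
-- The effect of substituting tz for the series variable z.
theorem hasLogDeriv_X_pow_mul {R : Type*} [CommRing R] {Q x : ℕ → R}
    (h : HasLogDeriv (PowerSeries.mk Q) (PowerSeries.mk x)) :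
    HasLogDeriv (PowerSeries.mk fun i => (X : R[X]) ^ (i + 1) * C (Q i))
      (PowerSeries.mk fun i => (X : R[X]) ^ i * C (x i)) := by
  obtain ⟨h0, hs⟩ := hasLogDeriv_mk_iff.1 h
  refine hasLogDeriv_mk_iff.2 ⟨by rw [h0]; simp, fun n => ?_⟩
  have h1 := congrArg (C : R →+* R[X]) (hs n)
  rw [map_mul, map_add, map_natCast, map_one] at h1
  rw [mul_left_comm, h1, map_sum, Finset.mul_sum]
  refine Finset.sum_congr rfl fun i hi => ?_
  rw [mem_range] at hi
  rw [C_mul, show n + 1 = i + 1 + (n - i) by omega, pow_add]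
  ring

theorem hasLogDeriv_completePlethysm : HasLogDeriv
    (PowerSeries.mk fun i : ℕ => powerSumPlethysm ℚ i.succPNat (schur ℚ col2))
    (PowerSeries.mk completePlethysm) := by
  have h := (hasLogDeriv_complete ℚ).map (MvPolynomial.aeval (R := ℚ)
    fun r : ℕ+ => powerSumPlethysm ℚ r (schur ℚ col2)).toRingHom
  convert h using 1
  · ext1 n
    simp [powerSum]
  · ext1 n
    rw [PowerSeries.coeff_map, PowerSeries.coeff_mk, PowerSeries.coeff_mk]
    rfl

theorem homogeneous_completePlethysm (n : ℕ) :
    (completePlethysm n).IsWeightedHomogeneous wt (2 * n) := by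
  refine homogeneous_of_hasLogDeriv hasLogDeriv_completePlethysm (fun n => ?_) n
  rw [powerSumPlethysm_schur_col2, ← zero_add (2 * (n + 1))]
  refine (MvPolynomial.isWeightedHomogeneous_C wt _).mul (MvPolynomial.IsWeightedHomogeneous.sub
    ?_ ?_)
  · have h := (MvPolynomial.isWeightedHomogeneous_X ℚ wt n.succPNat).pow 2
    rwa [smul_eq_mul, wt, Nat.succPNat_coe] at h
  · have h := MvPolynomial.isWeightedHomogeneous_X ℚ wt (n.succPNat * 2)
    rwa [wt, PNat.mul_coe, Nat.succPNat_coe, Nat.mul_comm] at h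

open Polynomial in
-- Since p_r[e_2] = (p_r² - p_{2r})/2, the t^(2r) terms cancel and p_r[e_2] shifts to p_r[e_2] + t^r
-- p_r. The generating series of the h_n[e_2] is thus multiplied by ∑ h_k (tz)^k.
theorem perp_one_completePlethysm (n k : ℕ) : perp 1 k (completePlethysm n) =
    if k ≤ n then complete ℚ k * completePlethysm (n - k) else 0 := by
  have h1 := hasLogDeriv_completePlethysm.map (shift 1).toRingHom
  have h2 := (hasLogDeriv_X_pow_mul (hasLogDeriv_complete ℚ)).mul
    (hasLogDeriv_completePlethysm.map (C : Sym ℚ →+* (Sym ℚ)[X]))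
  have h3 : (PowerSeries.mk fun i : ℕ => powerSumPlethysm ℚ i.succPNat (schur ℚ col2)).map
      (shift 1).toRingHom = (PowerSeries.mk fun i : ℕ => (X : (Sym ℚ)[X]) ^ (i + 1) *
        C (powerSum ℚ i.succPNat)) + (PowerSeries.mk fun i : ℕ =>
        powerSumPlethysm ℚ i.succPNat (schur ℚ col2)).map (C : Sym ℚ →+* (Sym ℚ)[X]) := by
    ext1 n
    rw [map_add, PowerSeries.coeff_map, PowerSeries.coeff_map, PowerSeries.coeff_mk,
      PowerSeries.coeff_mk, powerSumPlethysm_schur_col2]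
    change shift 1 _ = _
    rw [map_mul, map_sub, map_pow, shift_X, shift_X, shift_C, PNat.mul_coe, Nat.succPNat_coe,
      Pi.one_apply, Pi.one_apply, MvPolynomial.C_1, C_1, one_mul, one_mul, C_mul, C_sub, C_pow,
      powerSum]
    have h4 : (2 : (Sym ℚ)[X]) * C (MvPolynomial.C (1 / 2)) = 1 := by
      rw [← C_1, ← two_mul_C_half, C_mul, C_ofNat]
    rw [show ((2 : ℕ+) : ℕ) = 2 from rfl, pow_mul, Nat.succ_eq_add_one]
    linear_combination X ^ (n + 1) * C (MvPolynomial.X n.succPNat) * h4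
  rw [h3] at h1
  have h5 := congrArg (PowerSeries.coeff n) (h1.unique h2)
  rw [PowerSeries.coeff_mul, PowerSeries.coeff_map, PowerSeries.coeff_mk,
    Finset.Nat.sum_antidiagonal_eq_sum_range_succ_mk] at h5
  simp only [PowerSeries.coeff_mk, PowerSeries.coeff_map] at h5
  change shift 1 (completePlethysm n) = _ at h5
  rw [perp_apply, h5, finsetSum_coeff]
  simp only [mul_assoc, ← C_mul, coeff_X_pow_mul_C']
  rw [Finset.sum_ite_eq']
  exact if_congr (by rw [mem_range, Nat.lt_succ_iff]) rfl rfl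

open Classical in
-- Removing a horizontal strip reaches only one even diagram, `roundDown ρ`, and that strip has
-- `oddCols ρ` cells. The expansion of G is kept as a hypothesis so that the statement can serve
-- inside the induction below.
theorem hallForm_complete_mul_of_forall {G : Sym ℚ} {m : ℕ} (hG : ∀ κ : YoungDiagram,
    κ.card = 2 * m → hallForm G (schur ℚ κ) = if IsEven κ then 1 else 0) {ρ : YoungDiagram} {k : ℕ}
    (hρ : ρ.card = 2 * m + k) :
    hallForm (complete ℚ k * G) (schur ℚ ρ) = if oddCols ρ = k then 1 else 0 := by
  rw [hallForm_complete_mul_schur hρ.symm, Finset.sum_congr rfl fun κ hκ =>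
    hG κ (mem_partitionsOf.1 (mem_filter.1 hκ).1), sum_hStrip_isEven_left]
  exact if_congr (by omega) rfl rfl

open Classical in
/-- `h_n[e_2]` is the sum of the Schur functions of the even partitions of `2n`. -/
theorem hallForm_completePlethysm_schur {n : ℕ} {μ : YoungDiagram} (hμ : μ.card = 2 * n) :
    hallForm (completePlethysm n) (schur ℚ μ) = if IsEven μ then 1 else 0 := by
  induction n using Nat.strong_induction_on generalizing μ with
  | _ n ih =>
    by_cases h0 : n = 0
    · subst h0
      have h1 : IsEven (⊥ : YoungDiagram) := by
        intro j
        rw [YoungDiagram.colLen_eq_card]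
        simp [YoungDiagram.col]
      rw [card_eq_zero_iff.1 hμ, schur_bot, (hasLogDeriv_mk_iff.1 hasLogDeriv_completePlethysm).1,
        hallForm_one_one, if_pos h1]
    -- Both sides are tested on h_k s_ν with |ν| + k = 2n. The adjoint of h_k and induction give 1
    -- exactly when ν has k odd columns. On the other side the only even diagram reached is `roundUp
    -- ν`, of size |ν| + `oddCols ν`, which is the same condition. For k > n neither side
    -- contributes, as `oddCols ν` ≤ |ν| < k.
    · refine (hallForm_comm _ _).trans (apply_schur_eq (hallForm.flip (completePlethysm n))
        (fun κ => if IsEven κ then 1 else 0) (N := 2 * n) (by omega) (fun ν k hk hc => ?_) hμ)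
      have h1 := oddCols_le_card ν
      rw [LinearMap.flip_apply, hallForm_complete_mul, perp_one_completePlethysm,
        sum_hStrip_isEven_right]
      split_ifs with h2 h3 h3
      · rw [hallForm_comm, hallForm_complete_mul_of_forall (fun κ hκ => ih (n - k) (by omega) hκ)
          (by omega), if_pos (by omega)]
      · rw [hallForm_comm, hallForm_complete_mul_of_forall (fun κ hκ => ih (n - k) (by omega) hκ)
          (by omega), if_neg (by omega)]
      · omega
      · exact map_zero _

open Classical in
theorem hallForm_complete_mul_completePlethysm {m k : ℕ} {ρ : YoungDiagram}
    (hρ : ρ.card = 2 * m + k) : hallForm (complete ℚ k * completePlethysm m) (schur ℚ ρ) =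
      if oddCols ρ = k then 1 else 0 :=
  hallForm_complete_mul_of_forall (fun _ hκ => hallForm_completePlethysm_schur hκ) hρ

/-! ### Corners and the strips of an even partition -/

/-- The set of corners of `μ`. -/
def corners (μ : YoungDiagram) : Finset (ℕ × ℕ) :=
  μ.cells.filter fun c => (c.1 + 1, c.2) ∉ μ ∧ (c.1, c.2 + 1) ∉ μ

theorem numCorners_eq_card (μ : YoungDiagram) : numCorners μ = (corners μ).card := rfl

theorem mem_corners {μ : YoungDiagram} {i j : ℕ} :
    (i, j) ∈ corners μ ↔ (i, j) ∈ μ ∧ (i + 1, j) ∉ μ ∧ (i, j + 1) ∉ μ := by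
  rw [corners, mem_filter, YoungDiagram.mem_cells]

/-- The diagram obtained from `μ` by removing a set of corners. -/
def eraseCorners (μ : YoungDiagram) (s : Finset (ℕ × ℕ)) (hs : s ⊆ corners μ) : YoungDiagram where
  cells := μ.cells \ s
  isLowerSet := by
    rintro ⟨i, j⟩ ⟨i', j'⟩ hle h
    obtain ⟨hi, hj⟩ : i' ≤ i ∧ j' ≤ j := hle
    rw [mem_coe, mem_sdiff, YoungDiagram.mem_cells] at h ⊢
    refine ⟨μ.up_left_mem hi hj h.1, fun hmem => ?_⟩
    obtain ⟨-, h1, h2⟩ := mem_corners.1 (hs hmem)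
    rcases Nat.lt_or_ge i' i with hlt | hge
    · exact h1 (μ.up_left_mem hlt hj h.1)
    · rcases Nat.lt_or_ge j' j with hlt | hge'
      · exact h2 (μ.up_left_mem hi hlt h.1)
      · obtain rfl : i' = i := le_antisymm hi hge
        obtain rfl : j' = j := le_antisymm hj hge'
        exact h.2 hmem

theorem mem_eraseCorners {μ : YoungDiagram} {s : Finset (ℕ × ℕ)} {hs : s ⊆ corners μ}
    {c : ℕ × ℕ} : c ∈ eraseCorners μ s hs ↔ c ∈ μ ∧ c ∉ s := by
  rw [← YoungDiagram.mem_cells, eraseCorners, mem_sdiff, YoungDiagram.mem_cells]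

theorem card_sdiff_cells {ν μ : YoungDiagram} (h : ν ≤ μ) :
    (μ.cells \ ν.cells).card = μ.card - ν.card :=
  Finset.card_sdiff_of_subset h

open Classical in
/-- The diagrams obtained from `μ` by removing a strip which is both horizontal and vertical
correspond to the sets of corners of `μ`. -/
theorem card_filter_hStrip_vStrip {μ : YoungDiagram} {n k : ℕ} (h : n + k = μ.card) :
    ((partitionsOf n).filter fun ν => HStrip ν μ ∧ VStrip ν μ).card =
      (numCorners μ).choose k := by
  rw [numCorners_eq_card, ← Finset.card_powersetCard]
  refine Finset.card_nbij (fun ν => μ.cells \ ν.cells) ?_ ?_ ?_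
  · intro ν hν
    rw [mem_coe, mem_filter, mem_partitionsOf] at hν
    obtain ⟨hn, hh, hv⟩ := hν
    rw [mem_coe, mem_powersetCard, card_sdiff_cells hh.1]
    refine ⟨?_, by omega⟩
    rintro ⟨i, j⟩ hij
    rw [mem_sdiff, YoungDiagram.mem_cells, YoungDiagram.mem_cells] at hij
    exact mem_corners.2 ⟨hij.1, fun h => hij.2 (hh.2 i j h), fun h => hij.2 (hv.2 i j h)⟩
  · intro ν hν κ hκ heq
    have h1 := (mem_filter.1 (mem_coe.1 hν)).2.1.1
    have h2 := (mem_filter.1 (mem_coe.1 hκ)).2.1.1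
    refine YoungDiagram.ext ?_
    rw [← Finset.sdiff_sdiff_eq_self (YoungDiagram.cells_subset_iff.2 h1),
      ← Finset.sdiff_sdiff_eq_self (YoungDiagram.cells_subset_iff.2 h2)]
    exact congrArg (μ.cells \ ·) heq
  · intro s hs
    rw [mem_coe, mem_powersetCard] at hs
    have hsub : s ⊆ μ.cells := hs.1.trans (filter_subset _ _)
    have hdiff : μ.cells \ (eraseCorners μ s hs.1).cells = s :=
      Finset.sdiff_sdiff_eq_self hsub
    have hle : eraseCorners μ s hs.1 ≤ μ := fun c hc => (mem_eraseCorners.1 hc).1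
    refine ⟨eraseCorners μ s hs.1, mem_coe.2 (mem_filter.2 ⟨mem_partitionsOf.2 ?_, ⟨hle, ?_⟩,
      hle, ?_⟩), hdiff⟩
    · have h1 := card_sdiff_cells hle
      have h3 := congrArg Finset.card hdiff
      have h2 := card_mono hle
      omega
    · exact fun i j hij => mem_eraseCorners.2 ⟨μ.up_left_mem (Nat.le_succ i) le_rfl hij,
        fun hmem => (mem_corners.1 (hs.1 hmem)).2.1 hij⟩
    · exact fun i j hij => mem_eraseCorners.2 ⟨μ.up_left_mem le_rfl (Nat.le_succ j) hij,
        fun hmem => (mem_corners.1 (hs.1 hmem)).2.2 hij⟩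

theorem numCorners_pos {μ : YoungDiagram} (h : μ.card ≠ 0) : 0 < numCorners μ := by
  rw [numCorners_eq_card, Finset.card_pos]
  have h0 : μ.rowLen 0 ≠ 0 := by
    intro h0
    rw [card_eq_sum_colLen h0.le, Finset.sum_range_zero] at h
    exact h rfl
  have h1 : 0 < μ.colLen (μ.rowLen 0 - 1) :=
    YoungDiagram.mem_iff_lt_colLen.1 (YoungDiagram.mem_iff_lt_rowLen.2 (by omega))
  -- The bottom cell of the last column.
  refine ⟨(μ.colLen (μ.rowLen 0 - 1) - 1, μ.rowLen 0 - 1), mem_corners.2 ⟨?_, ?_, ?_⟩⟩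
  · rw [YoungDiagram.mem_iff_lt_colLen]
    omega
  · rw [YoungDiagram.mem_iff_lt_colLen]
    omega
  · have := μ.rowLen_anti 0 (μ.colLen (μ.rowLen 0 - 1) - 1) (Nat.zero_le _)
    rw [YoungDiagram.mem_iff_lt_rowLen]
    omega

theorem vStrip_of_card_add_one {ν μ : YoungDiagram} (hle : ν ≤ μ) (h : ν.card + 1 = μ.card) :
    VStrip ν μ := by
  refine ⟨hle, fun i j hij => ?_⟩
  by_contra hν
  have h1 : (i, j + 1) ∉ ν := fun h => hν (ν.up_left_mem le_rfl (Nat.le_succ j) h)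
  have h2 : (i, j) ∈ μ := μ.up_left_mem le_rfl (Nat.le_succ j) hij
  have h3 := card_sdiff_cells hle
  have h4 : ({(i, j), (i, j + 1)} : Finset (ℕ × ℕ)) ⊆ μ.cells \ ν.cells := by
    intro c hc
    rw [mem_insert, mem_singleton] at hc
    rw [mem_sdiff, YoungDiagram.mem_cells, YoungDiagram.mem_cells]
    rcases hc with rfl | rfl
    · exact ⟨h2, hν⟩
    · exact ⟨hij, h1⟩
  have h5 := Finset.card_le_card h4
  rw [Finset.card_pair (by simp)] at h5
  omega

open Classical in
theorem sum_hStrip_oddCols_one {μ : YoungDiagram} (hμ : IsEven μ) {n : ℕ} (h : n + 1 = μ.card) :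
    (∑ ρ ∈ (partitionsOf n).filter (HStrip · μ), if oddCols ρ = 1 then (1 : ℚ) else 0) =
      numCorners μ := by
  have h1 := card_filter_hStrip_vStrip h
  rw [Nat.choose_one_right] at h1
  rw [← h1, Finset.card_eq_sum_ones, Nat.cast_sum]
  refine Finset.sum_congr (Finset.filter_congr fun ρ hρ => ?_) fun ρ hρ => ?_
  · rw [mem_partitionsOf] at hρ
    exact ⟨fun hs => ⟨hs, vStrip_of_card_add_one hs.1 (by omega)⟩, fun hs => hs.1⟩
  · rw [mem_filter, mem_partitionsOf] at hρ
    have := oddCols_add_card_of_hStrip hμ hρ.2.1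
    rw [if_pos (by omega), Nat.cast_one]

open Classical in
-- When μ is even and μ/ν has two cells, having two odd columns in ν is the same as μ/ν being a
-- horizontal strip. The sum therefore counts pairs of corners.
theorem sum_vStrip_oddCols_two {μ : YoungDiagram} (hμ : IsEven μ) {n : ℕ} (h : n + 2 = μ.card) :
    (∑ ν ∈ (partitionsOf n).filter (VStrip · μ), if oddCols ν = 2 then (1 : ℚ) else 0) =
      (numCorners μ).choose 2 := by
  rw [← card_filter_hStrip_vStrip h, ← Finset.sum_filter, Finset.filter_filter,
    Finset.sum_const, nsmul_eq_mul, mul_one]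
  congr 2
  refine Finset.filter_congr fun ν hν => ?_
  rw [mem_partitionsOf] at hν
  constructor
  · rintro ⟨h1, h2⟩
    exact ⟨hStrip_of_oddCols hμ h1.1 (by omega), h1⟩
  · rintro ⟨h1, h2⟩
    have := oddCols_add_card_of_hStrip hμ h1
    exact ⟨h2, by omega⟩

/-! ### Vertical strips of size two over an even partition -/

/-- An odd column of μ exceeds the even column of ν by an odd number, hence by one of the two cells.
The other cell lies in a single further column, which is odd too. -/
theorem hasTwoDistinctOddColumns_of_vStrip {ν μ : YoungDiagram} (hμ : ¬ IsEven μ) (hν : IsEven ν)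
    (hs : VStrip ν μ) (hc : ν.card + 2 = μ.card) :
    HasTwoDistinctOddColumns μ ∧ ν = roundDown μ := by
  have hle := le_iff_colLen.1 hs.1
  have heven := isEven_iff_mod.1 hν
  set M := μ.rowLen 0 with hM
  have hνM : ν.rowLen 0 ≤ M := le_iff_rowLen.1 hs.1 0
  have hsum : ∑ j ∈ range M, (μ.colLen j - ν.colLen j) = 2 := by
    have h1 : ∑ j ∈ range M, ν.colLen j + ∑ j ∈ range M, (μ.colLen j - ν.colLen j) =
        ∑ j ∈ range M, μ.colLen j := by
      rw [← Finset.sum_add_distrib]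
      exact Finset.sum_congr rfl fun j _ => by have := hle j; omega
    rw [← card_eq_sum_colLen hνM, ← card_eq_sum_colLen le_rfl] at h1
    omega
  rw [isEven_iff_mod] at hμ
  push Not at hμ
  obtain ⟨i, hi⟩ := hμ
  have hout : ∀ j, j ∉ range M → μ.colLen j = 0 := fun j hj =>
    colLen_eq_zero (by simpa using hj)
  have hiM : i ∈ range M := by
    by_contra h
    rw [hout i h] at hi
    exact hi rfl
  rw [← Finset.add_sum_erase _ _ hiM] at hsum
  have hdi : μ.colLen i - ν.colLen i = 1 ∧
      ∑ j ∈ (range M).erase i, (μ.colLen j - ν.colLen j) = 1 := by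
    have h1 := heven i
    have h2 := hle i
    omega
  obtain ⟨j, hj, hj0⟩ : ∃ j ∈ (range M).erase i, μ.colLen j - ν.colLen j ≠ 0 := by
    by_contra! h
    rw [Finset.sum_eq_zero h] at hdi
    omega
  have hsum2 := hdi.2
  rw [← Finset.add_sum_erase _ _ hj] at hsum2
  have hrest : ∑ k ∈ ((range M).erase i).erase j, (μ.colLen k - ν.colLen k) = 0 := by omega
  rw [Finset.sum_eq_zero_iff] at hrest
  have hk : ∀ k, k ≠ i → k ≠ j → μ.colLen k = ν.colLen k := by
    intro k hki hkj
    by_cases hkM : k ∈ range M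
    · have h1 := hrest k (by simp [hki, hkj, mem_range.1 hkM])
      have h2 := hle k
      omega
    · have h2 := hle k
      rw [hout k hkM] at h2 ⊢
      omega
  have hij : j ≠ i := (mem_erase.1 hj).1
  have hi1 := heven i
  have hj1 := heven j
  -- Columns of equal length would put both removed cells in one row; the columns between have that
  -- length too, which contradicts the vertical strip condition next to column a.
  have hne : ∀ a b, a < b → μ.colLen a - ν.colLen a = 1 → μ.colLen b - ν.colLen b = 1 →
      μ.colLen a ≠ μ.colLen b := by
    intro a b hab ha hb heq
    have h1 := μ.colLen_anti (a + 1) b hab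
    have h2 : (ν.colLen a, a + 1) ∈ μ := YoungDiagram.mem_iff_lt_colLen.2 (by omega)
    have h3 := YoungDiagram.mem_iff_lt_colLen.1 (hs.2 _ _ h2)
    exact lt_irrefl _ h3
  refine ⟨⟨i, j, Nat.odd_iff.2 (by omega), Nat.odd_iff.2 (by omega), ?_, fun k hki hkj => ?_⟩, ?_⟩
  · rcases lt_or_gt_of_ne hij with h | h
    · exact (hne j i h (by omega) hdi.1).symm
    · exact hne i j h hdi.1 (by omega)
  · rw [Nat.even_iff, hk k hki hkj]
    exact heven k
  · refine ext_colLen fun k => ?_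
    rw [colLen_roundDown]
    by_cases hki : k = i
    · subst hki
      omega
    · by_cases hkj : k = j
      · subst hkj
        omega
      · have h1 := hk k hki hkj
        have h2 := heven k
        omega

theorem oddCols_of_hasTwoDistinctOddColumns {μ : YoungDiagram} (h : HasTwoDistinctOddColumns μ) :
    oddCols μ = 2 := by
  obtain ⟨i, j, hi, hj, hij, hk⟩ := h
  have hne : i ≠ j := fun h => hij (by rw [h])
  have hM : ∀ {c}, Odd (μ.colLen c) → c ∈ range (μ.rowLen 0) := by
    intro c hc
    by_contra h
    rw [colLen_eq_zero (by simpa using h)] at hc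
    exact Nat.not_odd_zero hc
  have hsub : ({i, j} : Finset ℕ) ⊆ range (μ.rowLen 0) := by
    intro c hc
    rw [mem_insert, mem_singleton] at hc
    rcases hc with rfl | rfl
    · exact hM hi
    · exact hM hj
  rw [oddCols, ← Finset.sum_subset hsub, Finset.sum_pair hne, Nat.odd_iff.1 hi, Nat.odd_iff.1 hj]
  intro c _ hc
  rw [mem_insert, mem_singleton, not_or] at hc
  exact Nat.even_iff.1 (hk c hc.1 hc.2)

/-- An odd column differs in length from the next column, which is thus strictly shorter, so the
cell removed from its bottom has no cell of μ to its right. -/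
theorem vStrip_roundDown {μ : YoungDiagram} (h : HasTwoDistinctOddColumns μ) :
    VStrip (roundDown μ) μ := by
  obtain ⟨i, j, hi, hj, hij, hk⟩ := h
  refine ⟨(hStrip_isEven_left_iff.2 rfl).1.1, fun r c hrc => ?_⟩
  rw [YoungDiagram.mem_iff_lt_colLen] at hrc
  rw [YoungDiagram.mem_iff_lt_colLen, colLen_roundDown]
  have hanti := μ.colLen_anti c (c + 1) (Nat.le_succ c)
  have hodd : ∀ d, ¬ (d = i ∨ d = j) → μ.colLen d % 2 = 0 := fun d hd =>
    Nat.even_iff.1 (hk d (fun h => hd (Or.inl h)) fun h => hd (Or.inr h))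
  by_cases hc : c = i ∨ c = j
  · have h1 : μ.colLen (c + 1) ≠ μ.colLen c := by
      intro heq
      by_cases hc' : c + 1 = i ∨ c + 1 = j
      · rcases hc with rfl | rfl
        · rcases hc' with h | h
          · omega
          · exact hij (by rw [← h, heq])
        · rcases hc' with h | h
          · exact hij (by rw [← h, heq])
          · omega
      · have h2 := hodd _ hc'
        have h3 : μ.colLen c % 2 = 1 := by
          rcases hc with rfl | rfl
          · exact Nat.odd_iff.1 hi
          · exact Nat.odd_iff.1 hj
        omega
    omega
  · have := hodd c hc
    omega

open Classical in
theorem sum_vStrip_isEven {μ : YoungDiagram} (hμ : ¬ IsEven μ) {n : ℕ} (h : n + 2 = μ.card) :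
    (∑ ν ∈ (partitionsOf n).filter (VStrip · μ), if IsEven ν then (1 : ℚ) else 0) =
      if HasTwoDistinctOddColumns μ then 1 else 0 := by
  split_ifs with h2
  · have h3 := card_roundDown μ
    rw [oddCols_of_hasTwoDistinctOddColumns h2] at h3
    have hmem : roundDown μ ∈ (partitionsOf n).filter (VStrip · μ) :=
      mem_filter.2 ⟨mem_partitionsOf.2 (by omega), vStrip_roundDown h2⟩
    rw [Finset.sum_eq_single_of_mem _ hmem, if_pos (hStrip_isEven_left_iff.2 rfl).2]
    intro ν hν hne
    rw [mem_filter, mem_partitionsOf] at hν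
    exact if_neg fun he => hne (hasTwoDistinctOddColumns_of_vStrip hμ he hν.2 (by omega)).2
  · refine Finset.sum_eq_zero fun ν hν => if_neg fun he => h2 ?_
    rw [mem_filter, mem_partitionsOf] at hν
    exact (hasTwoDistinctOddColumns_of_vStrip hμ he hν.2 (by omega)).1

/-! ### The coefficients of the plethysm with e_2 -/

open Classical in
theorem completePlethysm_eq_sum (n : ℕ) :
    completePlethysm n = ∑ ν ∈ (partitionsOf (2 * n)).filter IsEven, schur ℚ ν := by
  rw [Finset.sum_filter]
  refine (eq_sum_hallForm_smul_schur (homogeneous_completePlethysm n)).trans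
    (Finset.sum_congr rfl fun μ hμ => ?_)
  rw [hallForm_comm, hallForm_completePlethysm_schur (mem_partitionsOf.1 hμ), ite_smul, one_smul,
    zero_smul]

theorem evenLRSum_eq (h : ℕ) (μ : YoungDiagram) : evenLRSum h μ =
    hallForm (completePlethysm (h - 2) * schur ℚ shape211) (schur ℚ μ) := by
  rw [hallForm_comm, completePlethysm_eq_sum, Finset.sum_mul, map_sum]
  rfl

/-- Only the h_2 e_2 part of s_{(2,1,1)} survives. For even μ the h_4 term would need four odd
columns. Removing a horizontal strip of size 3 leaves three odd columns, whereas the h_3 h_1 term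
would need one. -/
theorem hallForm_completePlethysm_mul_shape211 {h : ℕ} (hh : 3 ≤ h) {μ : YoungDiagram}
    (hμ : μ.card = 2 * h) (he : IsEven μ) :
    hallForm (completePlethysm (h - 2) * schur ℚ shape211) (schur ℚ μ) =
      (numCorners μ).choose 2 := by
  classical
  have h0 : oddCols μ = 0 := isEven_iff_oddCols.1 he
  have hG : completePlethysm (h - 2) * schur ℚ shape211 =
      omega (complete ℚ 2) * (complete ℚ 2 * completePlethysm (h - 2)) -
        complete ℚ 3 * (complete ℚ 1 * completePlethysm (h - 2)) +
        complete ℚ 4 * completePlethysm (h - 2) := by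
    rw [schur_shape211, schur_col2_eq_omega]
    ring
  rw [hG, map_add, map_sub, LinearMap.add_apply, LinearMap.sub_apply,
    hallForm_complete_mul_completePlethysm (by omega), if_neg (by omega),
    hallForm_complete_mul_schur (n := 2 * h - 3) (by omega),
    hallForm_omega_complete_mul_schur (n := 2 * h - 2) (by omega), Finset.sum_eq_zero
    (s := (partitionsOf (2 * h - 3)).filter (HStrip · μ)) fun ρ hρ => ?_, sub_zero, add_zero,
    ← sum_vStrip_oddCols_two he (n := 2 * h - 2) (by omega)]
  · refine Finset.sum_congr rfl fun ν hν => ?_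
    rw [mem_filter, mem_partitionsOf] at hν
    exact hallForm_complete_mul_completePlethysm (by omega)
  · rw [mem_filter, mem_partitionsOf] at hρ
    have := oddCols_add_card_of_hStrip he hρ.2
    rw [hallForm_complete_mul_completePlethysm (by omega), if_neg (by omega)]

/-- With e_2 = h_1² - h_2, the h_2 term needs two odd columns and vanishes, and h_1² counts the ways
to remove one corner. -/
theorem hallForm_completePlethysm_mul_col2_of_isEven {h : ℕ} (hh : 3 ≤ h) {μ : YoungDiagram}
    (hμ : μ.card = 2 * h) (he : IsEven μ) :
    hallForm (completePlethysm (h - 1) * schur ℚ col2) (schur ℚ μ) = numCorners μ := by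
  classical
  have h0 : oddCols μ = 0 := isEven_iff_oddCols.1 he
  have hG : completePlethysm (h - 1) * schur ℚ col2 =
      complete ℚ 1 * (complete ℚ 1 * completePlethysm (h - 1)) -
        complete ℚ 2 * completePlethysm (h - 1) := by
    rw [schur_col2_eq_sub]
    ring
  rw [hG, map_sub, LinearMap.sub_apply, hallForm_complete_mul_completePlethysm (by omega),
    if_neg (by omega), sub_zero, hallForm_complete_mul_schur (n := 2 * h - 1) (by omega),
    ← sum_hStrip_oddCols_one he (n := 2 * h - 1) (by omega)]
  refine Finset.sum_congr rfl fun ν hν => ?_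
  rw [mem_filter, mem_partitionsOf] at hν
  exact hallForm_complete_mul_completePlethysm (by omega)

open Classical in
-- Here e_2 is better treated as a whole: its adjoint removes vertical strips and leaves
-- Littlewood's expansion of the other factor.
theorem hallForm_completePlethysm_mul_col2_of_not_isEven {h : ℕ} (hh : 3 ≤ h) {μ : YoungDiagram}
    (hμ : μ.card = 2 * h) (he : ¬ IsEven μ) :
    hallForm (completePlethysm (h - 1) * schur ℚ col2) (schur ℚ μ) =
      if HasTwoDistinctOddColumns μ then 1 else 0 := by
  rw [mul_comm, schur_col2_eq_omega, hallForm_omega_complete_mul_schur (n := 2 * h - 2) (by omega),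
    ← sum_vStrip_isEven he (n := 2 * h - 2) (by omega)]
  refine Finset.sum_congr rfl fun ν hν => ?_
  rw [mem_filter, mem_partitionsOf] at hν
  exact hallForm_completePlethysm_schur (by omega)

theorem plethysm_add {K : Type*} [CommRing K] [Algebra ℚ K] (f f' : Sym K) (g : Sym ℚ) :
    plethysm (f + f') g = plethysm f g + plethysm f' g := map_add _ _ _

theorem plethysm_sub {K : Type*} [CommRing K] [Algebra ℚ K] (f f' : Sym K) (g : Sym ℚ) :
    plethysm (f - f') g = plethysm f g - plethysm f' g := map_sub _ _ _

theorem plethysm_mul {K : Type*} [CommRing K] [Algebra ℚ K] (f f' : Sym K) (g : Sym ℚ) :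
    plethysm (f * f') g = plethysm f g * plethysm f' g := map_mul _ _ _

theorem completePlethysm_one : completePlethysm 1 = schur ℚ col2 := by
  rw [completePlethysm, complete_one_rat, plethysm, MvPolynomial.aeval_X,
    powerSumPlethysm_schur_col2, one_mul, schur_col2]

theorem plethysm_schur_hook (h : ℕ) (hh : 3 ≤ h) : plethysm (schur ℚ (hook h hh)) (schur ℚ col2) =
    completePlethysm (h - 2) * schur ℚ shape211 - completePlethysm (h - 1) * schur ℚ col2 +
      completePlethysm h := by
  have h1 : plethysm (complete ℚ 1) (schur ℚ col2) = schur ℚ col2 := completePlethysm_one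
  rw [schur_hook, plethysm_add, plethysm_sub, plethysm_mul, plethysm_mul,
    plethysm_schur_col2_col2, h1]
  rfl

theorem card_col2 : col2.card = 2 := by
  rw [card_eq_sum_rowLen (M := 2) (colLen_zero_le (by rw [col2, rowLen_ofRowLens']; rfl)), col2]
  simp only [rowLen_ofRowLens']
  rfl

theorem card_shape211 : shape211.card = 4 := by
  rw [card_eq_sum_rowLen (M := 3) (colLen_zero_le (by rw [shape211, rowLen_ofRowLens']; rfl)),
    shape211]
  simp only [rowLen_ofRowLens']
  rfl

theorem plethysm_schur_hook_col2 (h : ℕ) (hh : 3 ≤ h) :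
    plethysm (schur ℚ (hook h hh)) (schur ℚ col2) =
      ∑ μ ∈ partitionsOf (2 * h), hookCoeff h μ • schur ℚ μ := by
  classical
  have hhom : (plethysm (schur ℚ (hook h hh)) (schur ℚ col2)).IsWeightedHomogeneous wt (2 * h) := by
    rw [plethysm_schur_hook]
    refine (MvPolynomial.IsWeightedHomogeneous.sub ?_ ?_).add (homogeneous_completePlethysm h)
    · have h1 := (homogeneous_completePlethysm (h - 2)).mul (homogeneous_schur shape211)
      rwa [card_shape211, show 2 * (h - 2) + 4 = 2 * h by omega] at h1
    · have h1 := (homogeneous_completePlethysm (h - 1)).mul (homogeneous_schur col2)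
      rwa [card_col2, show 2 * (h - 1) + 2 = 2 * h by omega] at h1
  refine (eq_sum_hallForm_smul_schur hhom).trans (Finset.sum_congr rfl fun μ hμ => ?_)
  rw [mem_partitionsOf] at hμ
  congr 1
  rw [hallForm_comm, plethysm_schur_hook, map_add, map_sub, LinearMap.add_apply,
    LinearMap.sub_apply, hallForm_completePlethysm_schur hμ, hookCoeff]
  by_cases he : IsEven μ
  · rw [if_pos he, if_pos he, hallForm_completePlethysm_mul_shape211 hh hμ he,
      hallForm_completePlethysm_mul_col2_of_isEven hh hμ he]
    -- A nonempty diagram has a corner, so the truncated subtraction in `hookCoeff` is genuine;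
    -- Pascal's rule gives binom(b+1,2) - (b+1) + 1 = binom(b,2).
    obtain ⟨b, hb⟩ : ∃ b, numCorners μ = b + 1 :=
      ⟨numCorners μ - 1, by have := numCorners_pos (μ := μ) (by omega); omega⟩
    rw [hb, Nat.add_sub_cancel, Nat.choose_succ_succ' b 1, Nat.choose_one_right]
    push_cast
    ring
  · rw [if_neg he, if_neg he, hallForm_completePlethysm_mul_col2_of_not_isEven hh hμ he,
      ← evenLRSum_eq, add_zero]
    split_ifs
    · rfl
    · rw [sub_zero]

/-! ### Passing from e_2 to h_2 by ω -/

theorem transpose_col2 : col2.transpose = row2 := by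
  refine ext_colLen fun j => ?_
  rw [YoungDiagram.colLen_transpose, col2, rowLen_ofRowLens', row2]
  refine eq_of_forall_lt_iff fun i => ?_
  rw [← YoungDiagram.mem_iff_lt_colLen, YoungDiagram.mem_iff_lt_rowLen, rowLen_ofRowLens']
  rcases i with _ | i <;> rcases j with _ | _ | j <;> simp

/-- No sign depending on f appears, because the inner degree 2 is even: ω fixes p_r² and negates
p_{2r}, hence sends p_r[e_2] to p_r[h_2] for every r. -/
theorem plethysm_schur_row2 (f : Sym ℚ) :
    plethysm f (schur ℚ row2) = omega (plethysm f (schur ℚ col2)) := by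
  have hr : ∀ r : ℕ+, powerSumPlethysm ℚ r (schur ℚ row2) =
      omega (powerSumPlethysm ℚ r (schur ℚ col2)) := by
    intro r
    have h1 : sgn 1 = 1 := by norm_num [sgn]
    have h2 : ∀ r : ℕ+, sgn (r * 2) = -1 := fun r => by
      rw [sgn, PNat.mul_coe, pow_succ, show ((2 : ℕ+) : ℕ) = 2 from rfl, pow_mul']
      norm_num
    have h3 : schur ℚ row2 = MvPolynomial.C (1 / 2) *
        (MvPolynomial.X 1 ^ 2 + MvPolynomial.X 2) := by
      have := h2 1
      rw [one_mul] at this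
      rw [← transpose_col2, ← omega_schur, schur_col2, map_mul, map_sub, map_pow, omega_X, omega_X,
        omega_C, h1, this, MvPolynomial.C_neg, MvPolynomial.C_1]
      ring
    have h4 : (MvPolynomial.C (sgn r) : Sym ℚ) * MvPolynomial.C (sgn r) = 1 := by
      rw [← MvPolynomial.C_mul, sgn_mul_self, MvPolynomial.C_1]
    rw [powerSumPlethysm_schur_col2, powerSumPlethysm, h3, map_mul, map_add, map_pow,
      MvPolynomial.aeval_X, MvPolynomial.aeval_X, mul_one, MvPolynomial.aeval_C, map_mul, map_sub,
      map_pow, omega_X, omega_X, omega_C, h2, MvPolynomial.C_neg, MvPolynomial.C_1, powerSum,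
      powerSum, MvPolynomial.algebraMap_eq]
    linear_combination -MvPolynomial.C (1 / 2) * MvPolynomial.X r ^ 2 * h4
  have h : (MvPolynomial.aeval fun r : ℕ+ => powerSumPlethysm ℚ r (schur ℚ row2)) =
      omega.comp (MvPolynomial.aeval fun r : ℕ+ => powerSumPlethysm ℚ r (schur ℚ col2)) := by
    refine MvPolynomial.algHom_ext fun r => ?_
    rw [AlgHom.comp_apply, MvPolynomial.aeval_X, MvPolynomial.aeval_X, hr]
  exact congrArg (fun φ : Sym ℚ →ₐ[ℚ] Sym ℚ => φ f) h

/-! ### Extension of scalars from ℚ to K -/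

section BaseChange

variable (K : Type*) [CommRing K] [Algebra ℚ K]

theorem map_schur (μ : YoungDiagram) :
    MvPolynomial.map (algebraMap ℚ K) (schur ℚ μ) = schur K μ := by
  rw [schur, schur, RingHom.map_det]
  congr 1
  ext1 i j
  simp only [RingHom.mapMatrix_apply, Matrix.map_apply, Matrix.of_apply]
  split_ifs
  · exact map_complete K _
  · exact map_zero _

theorem map_plethysm (f g : Sym ℚ) : MvPolynomial.map (algebraMap ℚ K) (plethysm f g) =
    plethysm (MvPolynomial.map (algebraMap ℚ K) f) g := by
  have h1 : ∀ r : ℕ+, MvPolynomial.map (algebraMap ℚ K) (powerSumPlethysm ℚ r g) =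
      powerSumPlethysm K r g := by
    intro r
    have h : (MvPolynomial.map (algebraMap ℚ K)).comp
        (MvPolynomial.aeval (R := ℚ) fun i : ℕ+ => powerSum ℚ (r * i)).toRingHom =
        (MvPolynomial.aeval (R := ℚ) fun i : ℕ+ => powerSum K (r * i)).toRingHom := by
      refine MvPolynomial.ringHom_ext (fun a => ?_) fun i => ?_
      · change MvPolynomial.map _ (MvPolynomial.aeval _ (MvPolynomial.C a)) =
          MvPolynomial.aeval _ (MvPolynomial.C a)
        rw [MvPolynomial.aeval_C, MvPolynomial.aeval_C, MvPolynomial.algebraMap_eq,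
          MvPolynomial.map_C, MvPolynomial.algebraMap_apply]
      · simp [powerSum]
    exact congrArg (fun φ : Sym ℚ →+* Sym K => φ g) h
  have h : (MvPolynomial.map (algebraMap ℚ K)).comp
      (MvPolynomial.aeval (R := ℚ) fun r : ℕ+ => powerSumPlethysm ℚ r g).toRingHom =
      (MvPolynomial.aeval (R := K) fun r : ℕ+ => powerSumPlethysm K r g).toRingHom.comp
        (MvPolynomial.map (algebraMap ℚ K)) := by
    refine MvPolynomial.ringHom_ext (fun a => ?_) fun i => ?_
    · change MvPolynomial.map _ (MvPolynomial.aeval _ (MvPolynomial.C a)) =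
        MvPolynomial.aeval _ (MvPolynomial.map _ (MvPolynomial.C a))
      rw [MvPolynomial.map_C, MvPolynomial.aeval_C, MvPolynomial.aeval_C,
        MvPolynomial.algebraMap_eq, MvPolynomial.map_C, MvPolynomial.algebraMap_eq]
    · simp [h1]
  exact congrArg (fun φ : Sym ℚ →+* Sym K => φ f) h

theorem map_rat_smul (a : ℚ) (f : Sym ℚ) : MvPolynomial.map (algebraMap ℚ K) (a • f) =
    a • MvPolynomial.map (algebraMap ℚ K) f := by
  rw [MvPolynomial.smul_eq_C_mul, map_mul, MvPolynomial.map_C, Algebra.smul_def,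
    MvPolynomial.algebraMap_apply]

end BaseChange

end SymFn

theorem mainTheorem7 (K : Type*) [CommRing K] [Algebra ℚ K] (h : ℕ) (hh : 3 ≤ h) :
    SymFn.plethysm (SymFn.schur K (SymFn.hook h hh)) (SymFn.schur ℚ SymFn.col2) =
        ∑ μ ∈ SymFn.partitionsOf (2 * h), SymFn.hookCoeff h μ • SymFn.schur K μ ∧
      SymFn.plethysm (SymFn.schur K (SymFn.hook h hh)) (SymFn.schur ℚ SymFn.row2) =
        ∑ μ ∈ SymFn.partitionsOf (2 * h), SymFn.hookCoeff h μ • SymFn.schur K μ.transpose := by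
  constructor
  · have h1 := congrArg (MvPolynomial.map (algebraMap ℚ K)) (SymFn.plethysm_schur_hook_col2 h hh)
    rw [SymFn.map_plethysm, SymFn.map_schur, map_sum] at h1
    refine h1.trans (Finset.sum_congr rfl fun μ _ => ?_)
    rw [SymFn.map_rat_smul, SymFn.map_schur]
  · have h1 := SymFn.plethysm_schur_row2 (SymFn.schur ℚ (SymFn.hook h hh))
    rw [SymFn.plethysm_schur_hook_col2, map_sum] at h1
    have h2 := congrArg (MvPolynomial.map (algebraMap ℚ K)) h1
    rw [SymFn.map_plethysm, SymFn.map_schur, map_sum] at h2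
    refine h2.trans (Finset.sum_congr rfl fun μ _ => ?_)
    rw [map_smul, SymFn.omega_schur, SymFn.map_rat_smul, SymFn.map_schur]
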